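/- Let $w>0$. For each $n\ge 1$ let $W=\{W^{(n)}_{jk}\}_{j,k=1}^n$ be a random real symmetric $n\times n$ matrix whose entries $W^{(n)}_{jk}$, $1\le j\le k\le n$, are independent random variables with $$\mathbf{E}\{W^{(n)}_{jk}\}=0,\qquad \mathbf{E}\{(W^{(n)}_{jk})^2\}=(1+\delta_{jk})w^2,$$ let $F^{(n)}_{jk}$ be the probability law of $W^{(n)}_{jk}$, and let $M=n^{-1/2}W$ be the corresponding Wigner matrix. Let $N_n(\Delta)=\#\{l:\lambda^{(n)}_l\in\Delta\}/n$ be the normalized counting measure of the eigenvalues $\lambda^{(n)}_1,\dots,\lambda^{(n)}_n$ of $M$, counted with multiplicity, and let $\mathbf{E}\{N_n\}$ be the probability measure $\Delta\mapsto\mathbf{E}\{N_n(\Delta)\}$ on $\mathbb{R}$. Suppose that $$\lim_{n\to\infty} n^{-2}\sum_{j,k=1}^n\int_{|x|>\tau\sqrt n}x^2\,F^{(n)}_{jk}(dx)=0\qquad\text{for every }\tau>0.$$ Then $\mathbf{E}\{N_n\}$ converges weakly, as $n\to\infty$, to the semicircle law $$N_{\mathrm{scl}}(d\lambda)=(2\pi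 w^2)^{-1}\sqrt{(4w^2-\lambda^2)_+}\,d\lambda,\qquad x_+=\max\{0,x\}.$$ -/

import Mathlib

open MeasureTheory ProbabilityTheory Filter Topology

noncomputable section

namespace Wigner

/-! ### The normalized counting measure of eigenvalues -/

/-- The normalized counting measure of the eigenvalues (with multiplicity) of a real symmetric
`n × n` matrix: the measure `Δ ↦ #{l : λ_l ∈ Δ} / n`. -/
def countingMeasure {n : ℕ} {A : Matrix (Fin n) (Fin n) ℝ} (hA : A.IsHermitian) : Measure ℝ :=
  (n : ENNReal)⁻¹ • ∑ l : Fin n, Measure.dirac (hA.eigenvalues l)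

instance countingMeasure.instIsProbabilityMeasure {n : ℕ} [NeZero n]
    {A : Matrix (Fin n) (Fin n) ℝ} (hA : A.IsHermitian) :
    IsProbabilityMeasure (countingMeasure hA) := by
  constructor
  simp only [countingMeasure, Measure.smul_apply, Measure.finsetSum_apply, measure_univ,
    Finset.sum_const, Finset.card_univ, Fintype.card_fin, smul_eq_mul, nsmul_eq_mul, mul_one]
  exact ENNReal.inv_mul_cancel (by simp [NeZero.ne n]) (by simp)

/-- The value on a set is the proportion of eigenvalues lying in that set. -/
theorem countingMeasure_apply {n : ℕ} {A : Matrix (Fin n) (Fin n) ℝ} (hA : A.IsHermitian)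
    {s : Set ℝ} (hs : MeasurableSet s) :
    countingMeasure hA s = (n : ENNReal)⁻¹ * ({l | hA.eigenvalues l ∈ s} : Set (Fin n)).ncard := by
  classical
  simp only [countingMeasure, Measure.smul_apply, Measure.finsetSum_apply,
    Measure.dirac_apply' _ hs, smul_eq_mul, Set.indicator_apply, Pi.one_apply]
  congr 1
  rw [Finset.sum_boole, Set.ncard_eq_toFinset_card']
  congr 2
  ext l
  simp

/-! ### Measurability of the counting measure in the random parameter -/

theorem trace_aeval_eq_sum {n : ℕ} {A : Matrix (Fin n) (Fin n) ℝ} (hA : A.IsHermitian)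
    (p : Polynomial ℝ) :
    (Polynomial.aeval A p).trace = ∑ l, p.eval (hA.eigenvalues l) := by
  have h := hA.spectral_theorem
  set u := hA.eigenvectorUnitary
  have h2 : Polynomial.aeval A p = Unitary.conjStarAlgAut ℝ _ u
      (Polynomial.aeval (Matrix.diagonal (RCLike.ofReal ∘ hA.eigenvalues)) p) := by
    conv_lhs => rw [h]
    exact Polynomial.aeval_algHom_apply
      ((Unitary.conjStarAlgAut ℝ (Matrix (Fin n) (Fin n) ℝ) u).toAlgEquiv.toAlgHom) _ p
  have h3 : Polynomial.aeval (Matrix.diagonal (RCLike.ofReal ∘ hA.eigenvalues)) p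
      = Matrix.diagonal (fun l => p.eval (hA.eigenvalues l)) := by
    have := Polynomial.aeval_algHom_apply (Matrix.diagonalAlgHom (n := Fin n) (α := ℝ) ℝ)
      (hA.eigenvalues) p
    have e : (RCLike.ofReal ∘ hA.eigenvalues : Fin n → ℝ) = hA.eigenvalues := by
      ext l; simp
    rw [e]
    simp only [Matrix.diagonalAlgHom_apply] at this
    rw [this]
    congr 1
    ext l
    rw [Polynomial.aeval_pi_apply]
    simp
  rw [h2, h3, Unitary.conjStarAlgAut_apply, Matrix.trace_mul_cycle]
  simp [Matrix.trace_diagonal]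

theorem measurable_pow_entry {Ω : Type*} [MeasurableSpace Ω] {n : ℕ}
    {M : Ω → Matrix (Fin n) (Fin n) ℝ} (hm : ∀ j k, Measurable fun ω => M ω j k) (m : ℕ) :
    ∀ j k, Measurable fun ω => (M ω ^ m) j k := by
  induction m with
  | zero => intro j k; simp
  | succ m ih =>
    intro j k
    simp only [pow_succ, Matrix.mul_apply]
    exact Finset.measurable_fun_sum _ fun l _ => (ih j l).mul (hm l k)

theorem measurable_sum_eval {Ω : Type*} [MeasurableSpace Ω] {n : ℕ}
    {M : Ω → Matrix (Fin n) (Fin n) ℝ} (hm : ∀ j k, Measurable fun ω => M ω j k)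
    (hM : ∀ ω, (M ω).IsHermitian) (p : Polynomial ℝ) :
    Measurable fun ω => ∑ l, p.eval ((hM ω).eigenvalues l) := by
  simp_rw [← trace_aeval_eq_sum (hM _) p, Polynomial.aeval_eq_sum_range, Matrix.trace,
    Matrix.diag, Matrix.sum_apply, Matrix.smul_apply]
  exact Finset.measurable_fun_sum _ fun j _ => Finset.measurable_fun_sum _ fun i _ =>
    (measurable_pow_entry hm i j j).const_mul (p.coeff i)

theorem exists_polynomial_tendsto_Iic (x : ℝ) :
    ∃ p : ℕ → Polynomial ℝ, ∀ y, Tendsto (fun m => (p m).eval y) atTop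
      (𝓝 ((Set.Iic x).indicator (fun _ => (1 : ℝ)) y)) := by
  have hc : ∀ m : ℕ, Continuous fun y : ℝ => max 0 (1 - (m : ℝ) * max 0 (y - x)) := by
    intro m; fun_prop
  choose p hp using fun m : ℕ => exists_polynomial_near_of_continuousOn (-(m : ℝ)) m
    (fun y : ℝ => max 0 (1 - (m : ℝ) * max 0 (y - x))) (hc m).continuousOn (1 / ((m : ℝ) + 1))
    (by positivity)
  refine ⟨p, fun y => ?_⟩
  have h1 : Tendsto (fun m : ℕ => (p m).eval y - max 0 (1 - (m : ℝ) * max 0 (y - x))) atTop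
      (𝓝 0) := by
    refine squeeze_zero_norm' ?_ tendsto_one_div_add_atTop_nhds_zero_nat
    obtain ⟨N, hN⟩ := exists_nat_ge |y|
    filter_upwards [eventually_ge_atTop N] with m hm
    have : |y| ≤ m := hN.trans (by exact_mod_cast hm)
    exact (hp m y (abs_le.mp this)).le
  have h2 : Tendsto (fun m : ℕ => max 0 (1 - (m : ℝ) * max 0 (y - x))) atTop
      (𝓝 ((Set.Iic x).indicator (fun _ => (1 : ℝ)) y)) := by
    by_cases hy : y ≤ x
    · have : max 0 (y - x) = 0 := max_eq_left (by linarith)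
      simp [hy]
    · have hpos : 0 < y - x := by linarith [not_le.mp hy]
      rw [Set.indicator_of_notMem (by simpa using hy)]
      refine tendsto_const_nhds.congr' ?_
      obtain ⟨N, hN⟩ := exists_nat_ge (1 / (y - x))
      filter_upwards [eventually_ge_atTop N] with m hm
      have h3 : 1 / (y - x) ≤ m := hN.trans (by exact_mod_cast hm)
      rw [div_le_iff₀ hpos] at h3
      rw [max_eq_right hpos.le, max_eq_left (by linarith)]
  simpa using h1.add h2

theorem measurable_countingMeasure {Ω : Type*} [MeasurableSpace Ω] {n : ℕ} [NeZero n]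
    {M : Ω → Matrix (Fin n) (Fin n) ℝ} (hm : ∀ j k, Measurable fun ω => M ω j k)
    (hM : ∀ ω, (M ω).IsHermitian) : Measurable fun ω => countingMeasure (hM ω) := by
  refine .measure_of_isPiSystem_of_isProbabilityMeasure (borel_eq_generateFrom_Iic ℝ)
    isPiSystem_Iic ?_
  rintro _ ⟨x, rfl⟩
  obtain ⟨p, hp⟩ := exists_polynomial_tendsto_Iic x
  have h1 : Measurable fun ω =>
      ∑ l, (Set.Iic x).indicator (fun _ => (1 : ℝ)) ((hM ω).eigenvalues l) := by
    refine measurable_of_tendsto_metrizable (fun m => measurable_sum_eval hm hM (p m)) ?_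
    rw [tendsto_pi_nhds]
    exact fun ω => tendsto_finsetSum _ fun l _ => hp _
  have h2 : ∀ ω, countingMeasure (hM ω) (Set.Iic x) = (n : ENNReal)⁻¹ * ENNReal.ofReal
      (∑ l, (Set.Iic x).indicator (fun _ => (1 : ℝ)) ((hM ω).eigenvalues l)) := by
    intro ω
    rw [ENNReal.ofReal_sum_of_nonneg
      (fun l _ => Set.indicator_nonneg (fun _ _ => zero_le_one) _)]
    simp only [countingMeasure, Measure.smul_apply, Measure.finsetSum_apply,
      Measure.dirac_apply' _ measurableSet_Iic, smul_eq_mul]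
    congr 1
    refine Finset.sum_congr rfl fun l _ => ?_
    by_cases h : (hM ω).eigenvalues l ≤ x <;> simp [h]
  simp_rw [h2]
  exact h1.ennreal_ofReal.const_mul _

/-- The expectation `E{N_n}` of the normalized counting measure of the eigenvalues of a random
real symmetric matrix `M`: the measure `Δ ↦ E{N_n(Δ)}`. -/
def expectedCountingMeasure {Ω : Type*} [MeasurableSpace Ω] (P : Measure Ω) {n : ℕ}
    (M : Ω → Matrix (Fin n) (Fin n) ℝ) (hM : ∀ ω, (M ω).IsHermitian) : Measure ℝ :=
  P.bind fun ω => countingMeasure (hM ω)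

theorem expectedCountingMeasure_apply {Ω : Type*} [MeasurableSpace Ω] (P : Measure Ω) {n : ℕ}
    [NeZero n] {M : Ω → Matrix (Fin n) (Fin n) ℝ} (hm : ∀ j k, Measurable fun ω => M ω j k)
    (hM : ∀ ω, (M ω).IsHermitian) {s : Set ℝ} (hs : MeasurableSet s) :
    expectedCountingMeasure P M hM s = ∫⁻ ω, countingMeasure (hM ω) s ∂P :=
  Measure.bind_apply hs (measurable_countingMeasure hm hM).aemeasurable

theorem isProbabilityMeasure_expectedCountingMeasure {Ω : Type*} [MeasurableSpace Ω]
    (P : Measure Ω) [IsProbabilityMeasure P] {n : ℕ}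
    [NeZero n] {M : Ω → Matrix (Fin n) (Fin n) ℝ} (hm : ∀ j k, Measurable fun ω => M ω j k)
    (hM : ∀ ω, (M ω).IsHermitian) : IsProbabilityMeasure (expectedCountingMeasure P M hM) := by
  constructor
  rw [expectedCountingMeasure_apply P hm hM MeasurableSet.univ]
  simp

/-! ### Wigner matrices -/

/-- The unnormalized real symmetric Wigner matrix `W` of size `n`, with variance parameter `w ^ 2`:
`W` is symmetric, its entries `W_{jk}`, `j ≤ k`, are independent, and
`E{W_{jk}} = 0`, `E{W_{jk} ^ 2} = (1 + δ_{jk}) w ^ 2`. -/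
structure IsWigner {Ω : Type*} [MeasurableSpace Ω] (P : Measure Ω) (w : ℝ) {n : ℕ}
    (W : Ω → Matrix (Fin n) (Fin n) ℝ) : Prop where
  symm : ∀ ω, (W ω).IsSymm
  measurable : ∀ j k, Measurable fun ω => W ω j k
  indep : iIndepFun (fun (e : {e : Fin n × Fin n // e.1 ≤ e.2}) ω => W ω e.1.1 e.1.2) P
  memLp_two : ∀ j k, MemLp (fun ω => W ω j k) 2 P
  mean : ∀ j k, ∫ ω, W ω j k ∂P = 0
  second_moment : ∀ j k, ∫ ω, (W ω j k) ^ 2 ∂P = (1 + if j = k then 1 else 0) * w ^ 2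

/-- The matrix `M = n^{-1/2} W`. -/
def normalize {n : ℕ} (W : Matrix (Fin n) (Fin n) ℝ) : Matrix (Fin n) (Fin n) ℝ :=
  (√(n : ℝ))⁻¹ • W

theorem IsWigner.isHermitian_normalize {Ω : Type*} [MeasurableSpace Ω] {P : Measure Ω} {w : ℝ}
    {n : ℕ} {W : Ω → Matrix (Fin n) (Fin n) ℝ} (hW : IsWigner P w W) (ω : Ω) :
    (normalize (W ω)).IsHermitian := by
  ext j k
  simp [normalize, (hW.symm ω).apply j k]

theorem IsWigner.measurable_normalize {Ω : Type*} [MeasurableSpace Ω] {P : Measure Ω} {w : ℝ}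
    {n : ℕ} {W : Ω → Matrix (Fin n) (Fin n) ℝ} (hW : IsWigner P w W) (j k : Fin n) :
    Measurable fun ω => normalize (W ω) j k :=
  (hW.measurable j k).const_smul ((√(n : ℝ))⁻¹)

/-- The expected normalized counting measure `E{N_n}` of the eigenvalues of the Wigner matrix
`M = n^{-1/2} W`, as a probability measure on the real line. -/
def IsWigner.expectedLaw {Ω : Type*} [MeasurableSpace Ω] {P : Measure Ω} [IsProbabilityMeasure P]
    {w : ℝ} {n : ℕ} [NeZero n] {W : Ω → Matrix (Fin n) (Fin n) ℝ} (hW : IsWigner P w W) :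
    ProbabilityMeasure ℝ :=
  ⟨expectedCountingMeasure P (fun ω => normalize (W ω)) hW.isHermitian_normalize,
    isProbabilityMeasure_expectedCountingMeasure P hW.measurable_normalize _⟩

/-- The quantity `n^{-2} ∑_{j,k} ∫_{|x| > τ √n} x² F_{jk}(dx)`, where `F_{jk}` is the law of the
entry `W_{jk}`. -/
def lindebergSum {Ω : Type*} [MeasurableSpace Ω] (P : Measure Ω) {n : ℕ}
    (W : Ω → Matrix (Fin n) (Fin n) ℝ) (τ : ℝ) : ℝ :=
  ((n : ℝ) ^ 2)⁻¹ * ∑ j, ∑ k, ∫ x in {x : ℝ | τ * √(n : ℝ) < |x|}, x ^ 2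
    ∂(P.map fun ω => W ω j k)

/-! ### The semicircle law -/

/-- The density `(2 π w²)⁻¹ √((4 w² - x²)₊)` of the semicircle law. -/
def semicircleDensity (w x : ℝ) : ℝ :=
  (2 * Real.pi * w ^ 2)⁻¹ * √(max 0 (4 * w ^ 2 - x ^ 2))

/-- The semicircle measure with density `semicircleDensity w`. -/
def semicircleMeasure (w : ℝ) : Measure ℝ :=
  volume.withDensity fun x => ENNReal.ofReal (semicircleDensity w x)

theorem semicircleDensity_nonneg (w x : ℝ) : 0 ≤ semicircleDensity w x := by
  have := Real.pi_pos
  unfold semicircleDensity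
  positivity

theorem semicircleDensity_eq_zero {w x : ℝ} (hw : 0 < w) (hx : x ∉ Set.Ioc (-(2 * w)) (2 * w)) :
    semicircleDensity w x = 0 := by
  have : 4 * w ^ 2 - x ^ 2 ≤ 0 := by
    simp only [Set.mem_Ioc, not_and_or, not_lt, not_le] at hx
    rcases hx with h | h <;> nlinarith
  simp [semicircleDensity, max_eq_left this]

theorem integral_semicircleDensity {w : ℝ} (hw : 0 < w) :
    ∫ x in -(2 * w)..(2 * w), semicircleDensity w x = 1 := by
  have hw2 : (2 * w) ≠ 0 := by positivity
  have h1 : ∀ x ∈ Set.uIcc (-1 : ℝ) 1,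
      semicircleDensity w (x * (2 * w)) = (Real.pi * w)⁻¹ * √(1 - x ^ 2) := by
    intro x hx
    rw [Set.uIcc_of_le (by norm_num)] at hx
    have hx2 : 0 ≤ 1 - x ^ 2 := by nlinarith [hx.1, hx.2]
    have e : 4 * w ^ 2 - (x * (2 * w)) ^ 2 = (2 * w) ^ 2 * (1 - x ^ 2) := by ring
    rw [semicircleDensity, e, max_eq_right (by positivity), Real.sqrt_mul (by positivity),
      Real.sqrt_sq (by positivity)]
    have := Real.pi_pos
    field_simp
  have h2 := intervalIntegral.integral_comp_mul_right (a := -1) (b := 1) (semicircleDensity w) hw2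
  rw [intervalIntegral.integral_congr h1, intervalIntegral.integral_const_mul,
    integral_sqrt_one_sub_sq] at h2
  have h3 : ∫ x in -(2 * w)..(2 * w), semicircleDensity w x
      = (2 * w) * ((Real.pi * w)⁻¹ * (Real.pi / 2)) := by
    rw [h2, smul_eq_mul, mul_inv_cancel_left₀ hw2]
    simp
  rw [h3]
  have := Real.pi_pos
  field_simp

theorem isProbabilityMeasure_semicircleMeasure {w : ℝ} (hw : 0 < w) :
    IsProbabilityMeasure (semicircleMeasure w) := by
  have hc : Continuous (semicircleDensity w) := by unfold semicircleDensity; fun_prop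
  have hint : IntegrableOn (semicircleDensity w) (Set.Ioc (-(2 * w)) (2 * w)) :=
    (hc.intervalIntegrable _ _).1
  constructor
  have hsupp : (fun x => ENNReal.ofReal (semicircleDensity w x)) =
      (Set.Ioc (-(2 * w)) (2 * w)).indicator fun x => ENNReal.ofReal (semicircleDensity w x) := by
    ext x
    by_cases hx : x ∈ Set.Ioc (-(2 * w)) (2 * w)
    · rw [Set.indicator_of_mem hx]
    · rw [Set.indicator_of_notMem hx, semicircleDensity_eq_zero hw hx, ENNReal.ofReal_zero]
  rw [semicircleMeasure, withDensity_apply _ MeasurableSet.univ, Measure.restrict_univ, hsupp,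
    lintegral_indicator measurableSet_Ioc, ← ofReal_integral_eq_lintegral_ofReal hint
      (Eventually.of_forall fun x => semicircleDensity_nonneg w x),
    ← intervalIntegral.integral_of_le (by linarith), integral_semicircleDensity hw]
  simp

/-- The semicircle law as a probability measure on the real line. -/
def semicircleLaw (w : ℝ) (hw : 0 < w) : ProbabilityMeasure ℝ :=
  ⟨semicircleMeasure w, isProbabilityMeasure_semicircleMeasure hw⟩

end Wigner

end

namespace Wigner

open scoped BoundedContinuousFunction

/-! ### Stieltjes transforms and weak convergence -/

/-! The proof is by Stieltjes transforms. Let `G = (M - z)⁻¹`, `g = tr G / n`, `b = 1 / Im z`, and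
let `s` be the transform of the semicircle law, which satisfies `1 + z s + w² s² = 0`. The second
moments of the expected laws are at most `2w²`, so these laws are tight, and it is enough that `E g
→ s` for `Im z > 2w` (`tendsto_of_tendsto_stieltjes`).

No separate concentration estimate for `g` is needed. Put `H = conj (g - s)`. Subtracting the
equation of `s` gives `H (1 + z g + w² g²) = |g - s|² (z + w² (g + s))`, and the last factor has
imaginary part at least `Im z - 2w² b > 0`. So `E|g - s|²` is controlled by `|E[H (1 + z g + w²
g²)]|` (`integral_norm_sq_sub_le`).

To see that this expectation is small, write `1 + z g = n⁻¹ ∑ M_jk G_kj` and compare `H` and `G`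
with their versions `H₀`, `G₀` in which the entry `(j, k)` is erased. To first order, `G_kj` is
`G₀_kj` minus a multiple of `M_jk (G₀_kj² + G₀_kk G₀_jj)`. Since `M_jk` is independent of `G₀` and
`H₀`, the leading term has mean zero, and `M_jk²` may be replaced by its mean. Summing, `G_kk G_jj`
yields `-w² g²`, while `∑ G_kj²` is only of order `n`. Only second moments are available, so the
remainder is split at `|M_jk| = τ`: small entries cost `O(τ)` and large ones the Lindeberg sum
(`norm_expansion_remainder_le`, `norm_integral_expansion_le`, `norm_integral_selfConsistent_le`). -/

theorem ofReal_sub_ne_zero {z : ℂ} (hz : z.im ≠ 0) (x : ℝ) : (x : ℂ) - z ≠ 0 := by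
  intro h
  apply hz
  have := congrArg Complex.im h
  simpa using this

theorem norm_inv_ofReal_sub_le {z : ℂ} (hz : z.im ≠ 0) (x : ℝ) :
    ‖((x : ℂ) - z)⁻¹‖ ≤ |z.im|⁻¹ := by
  rw [norm_inv]
  refine inv_anti₀ (abs_pos.mpr hz) ?_
  simpa using Complex.abs_im_le_norm ((x : ℂ) - z)

/-- The bounded continuous function `x ↦ (x - z)⁻¹` on the real line, for `z` not real. -/
noncomputable def cauchyKernel (z : ℂ) (hz : z.im ≠ 0) : ℝ →ᵇ ℂ :=
  BoundedContinuousFunction.ofNormedAddCommGroup (fun x : ℝ => ((x : ℂ) - z)⁻¹)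
    ((Complex.continuous_ofReal.sub continuous_const).inv₀ (ofReal_sub_ne_zero hz))
    |z.im|⁻¹ (norm_inv_ofReal_sub_le hz)

@[simp]
theorem cauchyKernel_apply (z : ℂ) (hz : z.im ≠ 0) (x : ℝ) :
    cauchyKernel z hz x = ((x : ℂ) - z)⁻¹ := rfl

/-- The scalar resolvent identity: it makes a product of two kernels at distinct points a linear
combination of them. -/
theorem cauchyKernel_sub (z u : ℂ) (hz : z.im ≠ 0) (hu : u.im ≠ 0) :
    cauchyKernel z hz - cauchyKernel u hu = (z - u) • (cauchyKernel z hz * cauchyKernel u hu) := by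
  ext x
  have h1 := ofReal_sub_ne_zero hz x
  have h2 := ofReal_sub_ne_zero hu x
  simp only [BoundedContinuousFunction.coe_sub, Pi.sub_apply, cauchyKernel_apply,
    BoundedContinuousFunction.coe_smul, BoundedContinuousFunction.coe_mul, Pi.mul_apply,
    smul_eq_mul]
  field_simp
  ring

theorem norm_cauchyKernel_le (z : ℂ) (hz : z.im ≠ 0) : ‖cauchyKernel z hz‖ ≤ |z.im|⁻¹ :=
  (BoundedContinuousFunction.norm_le (by positivity)).mpr (norm_inv_ofReal_sub_le hz)

/-- The constants together with the kernels `x ↦ (x - z)⁻¹`, `c < |Im z|`. -/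
noncomputable def cauchyKernels (c : ℝ) : Set (ℝ →ᵇ ℂ) :=
  {f | f = 1 ∨ ∃ z : ℂ, ∃ hz : z.im ≠ 0, c < |z.im| ∧ f = cauchyKernel z hz}

/-- For distinct points the product lies in the span by partial fractions. The square of a kernel is
a uniform limit of products with the kernels at `z + 1 / (m + 1)`; the shift is real, so the
imaginary part, and with it the condition `c < |Im|`, is unchanged. -/
theorem cauchyKernel_mul_mem {c : ℝ} {z u : ℂ} (hz : z.im ≠ 0) (hu : u.im ≠ 0)
    (hcz : c < |z.im|) (hcu : c < |u.im|) :
    cauchyKernel z hz * cauchyKernel u hu ∈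
      (Submodule.span ℂ (cauchyKernels c)).topologicalClosure := by
  have key : ∀ u' : ℂ, ∀ hu' : u'.im ≠ 0, c < |u'.im| → z ≠ u' →
      cauchyKernel z hz * cauchyKernel u' hu' ∈ Submodule.span ℂ (cauchyKernels c) := by
    intro u' hu' hcu' hne
    have e : cauchyKernel z hz * cauchyKernel u' hu' =
        (z - u')⁻¹ • (cauchyKernel z hz - cauchyKernel u' hu') := by
      rw [cauchyKernel_sub, inv_smul_smul₀ (sub_ne_zero.mpr hne)]
    rw [e]
    exact Submodule.smul_mem _ _ (Submodule.sub_mem _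
      (Submodule.subset_span (Or.inr ⟨z, hz, hcz, rfl⟩))
      (Submodule.subset_span (Or.inr ⟨u', hu', hcu', rfl⟩)))
  by_cases hne : z = u
  · subst hne
    have him : ∀ m : ℕ, (z + ((1 / ((m : ℝ) + 1) : ℝ) : ℂ)).im = z.im := by intro m; simp
    have him' : ∀ m : ℕ, (z + ((1 / ((m : ℝ) + 1) : ℝ) : ℂ)).im ≠ 0 := by
      intro m; rwa [him]
    refine mem_closure_of_tendsto (f := fun m : ℕ =>
      cauchyKernel z hz * cauchyKernel (z + ((1 / ((m : ℝ) + 1) : ℝ) : ℂ)) (him' m))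
      (b := atTop) ?_ (Eventually.of_forall fun m => ?_)
    · refine Tendsto.const_mul _ ?_
      rw [tendsto_iff_norm_sub_tendsto_zero]
      have h0 : Tendsto (fun m : ℕ => 1 / ((m : ℝ) + 1) * (|z.im|⁻¹ * |z.im|⁻¹)) atTop (𝓝 0) := by
        simpa using tendsto_one_div_add_atTop_nhds_zero_nat.mul_const (|z.im|⁻¹ * |z.im|⁻¹)
      refine squeeze_zero (fun _ => norm_nonneg _) (fun m => ?_) h0
      rw [cauchyKernel_sub, norm_smul]
      have hn : ‖z + ((1 / ((m : ℝ) + 1) : ℝ) : ℂ) - z‖ = 1 / ((m : ℝ) + 1) := by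
        rw [add_sub_cancel_left, Complex.norm_real, Real.norm_of_nonneg (by positivity)]
      rw [hn]
      gcongr
      refine (norm_mul_le _ _).trans (mul_le_mul ?_ (norm_cauchyKernel_le _ _) (norm_nonneg _)
        (by positivity))
      have := norm_cauchyKernel_le _ (him' m)
      rwa [him] at this
    · refine key _ _ (by rwa [him]) ?_
      intro h
      have h2 : (1 / ((m : ℝ) + 1) : ℝ) = 0 := by
        have := congrArg Complex.re h
        simp only [Complex.add_re, Complex.ofReal_re] at this
        linarith
      have : (0 : ℝ) < 1 / ((m : ℝ) + 1) := by positivity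
      linarith
  · exact Submodule.le_topologicalClosure _ (key u hu hcu hne)

theorem star_cauchyKernel (z : ℂ) (hz : z.im ≠ 0) :
    star (cauchyKernel z hz) = cauchyKernel (star z) (by simpa using hz) := by
  ext x
  simp

/-- Bilinearity reduces the span to generators, and joint continuity of multiplication passes to the
closure. -/
theorem mul_mem_closure_span_cauchyKernels {c : ℝ} {f g : ℝ →ᵇ ℂ}
    (hf : f ∈ (Submodule.span ℂ (cauchyKernels c)).topologicalClosure)
    (hg : g ∈ (Submodule.span ℂ (cauchyKernels c)).topologicalClosure) :
    f * g ∈ (Submodule.span ℂ (cauchyKernels c)).topologicalClosure := by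
  set V := Submodule.span ℂ (cauchyKernels c)
  have h1 : ∀ f ∈ V, ∀ g ∈ V, f * g ∈ V.topologicalClosure := by
    intro f hf g hg
    induction hf using Submodule.span_induction with
    | zero => simp
    | add a b _ _ ha hb => rw [add_mul]; exact Submodule.add_mem _ ha hb
    | smul a b _ hb => rw [smul_mul_assoc]; exact Submodule.smul_mem _ _ hb
    | mem a ha =>
      induction hg using Submodule.span_induction with
      | zero => simp
      | add b b' _ _ hb hb' => rw [mul_add]; exact Submodule.add_mem _ hb hb'
      | smul t b _ hb => rw [mul_smul_comm]; exact Submodule.smul_mem _ _ hb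
      | mem b hb =>
        rcases ha with rfl | ⟨z, hz, hcz, rfl⟩
        · rw [one_mul]
          exact Submodule.le_topologicalClosure _ (Submodule.subset_span hb)
        · rcases hb with rfl | ⟨u, hu, hcu, rfl⟩
          · rw [mul_one]
            exact Submodule.le_topologicalClosure _
              (Submodule.subset_span (Or.inr ⟨z, hz, hcz, rfl⟩))
          · exact cauchyKernel_mul_mem hz hu hcz hcu
  have h2 := map_mem_closure₂ (s := (V : Set (ℝ →ᵇ ℂ))) (t := (V : Set (ℝ →ᵇ ℂ)))
    (u := (V.topologicalClosure : Set (ℝ →ᵇ ℂ))) continuous_mul hf hg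
    (fun a ha b hb => h1 a ha b hb)
  exact V.isClosed_topologicalClosure.closure_subset h2

theorem star_mem_closure_span_cauchyKernels {c : ℝ} {f : ℝ →ᵇ ℂ}
    (hf : f ∈ (Submodule.span ℂ (cauchyKernels c)).topologicalClosure) :
    star f ∈ (Submodule.span ℂ (cauchyKernels c)).topologicalClosure := by
  refine map_mem_closure continuous_star hf fun g hg => ?_
  induction hg using Submodule.span_induction with
  | zero => simp
  | add a b _ _ ha hb => rw [star_add]; exact Submodule.add_mem _ ha hb
  | smul a b _ hb => rw [star_smul]; exact Submodule.smul_mem _ _ hb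
  | mem a ha =>
    refine Submodule.subset_span ?_
    rcases ha with rfl | ⟨z, hz, hcz, rfl⟩
    · exact Or.inl (star_one _)
    · exact Or.inr ⟨star z, by simpa using hz, by simpa using hcz, star_cauchyKernel z hz⟩

/-- The closed star subalgebra of bounded continuous functions spanned by the constants and the
kernels `x ↦ (x - z)⁻¹`, `c < |Im z|`. -/
noncomputable def cauchyKernelAlgebra (c : ℝ) : StarSubalgebra ℂ (ℝ →ᵇ ℂ) where
  carrier := (Submodule.span ℂ (cauchyKernels c)).topologicalClosure
  mul_mem' := mul_mem_closure_span_cauchyKernels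
  add_mem' := Submodule.add_mem _
  algebraMap_mem' t := by
    rw [Algebra.algebraMap_eq_smul_one]
    exact Submodule.smul_mem _ _
      (Submodule.le_topologicalClosure _ (Submodule.subset_span (Or.inl rfl)))
  star_mem' := star_mem_closure_span_cauchyKernels

theorem separatesPoints_cauchyKernelAlgebra (c : ℝ) :
    ((cauchyKernelAlgebra c).map
      (BoundedContinuousFunction.toContinuousMapStarₐ ℂ)).SeparatesPoints := by
  intro x y hxy
  -- A single kernel separates all points, because `x ↦ (x - z)⁻¹` is injective.
  set z : ℂ := ((|c| + 1 : ℝ) : ℂ) * Complex.I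
  have him : z.im = |c| + 1 := by simp [z]
  have hz : z.im ≠ 0 := by rw [him]; positivity
  have hcz : c < |z.im| := by
    rw [him, abs_of_pos (by positivity)]
    linarith [le_abs_self c]
  refine ⟨cauchyKernel z hz, ⟨BoundedContinuousFunction.toContinuousMapStarₐ ℂ (cauchyKernel z hz),
    ⟨cauchyKernel z hz, Submodule.le_topologicalClosure _
      (Submodule.subset_span (Or.inr ⟨z, hz, hcz, rfl⟩)), rfl⟩, rfl⟩, ?_⟩
  simpa using hxy

/-- A tight family of probability measures on the line whose Stieltjes transforms converge, at all
points far enough above the real axis, to that of a probability measure converges weakly to it. -/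
theorem tendsto_of_tendsto_stieltjes {ι : Type*} {F : Filter ι} {μ : ι → ProbabilityMeasure ℝ}
    {μ₀ : ProbabilityMeasure ℝ} (ht : IsTightMeasureSet {(μ n : Measure ℝ) | n})
    (c : ℝ) (h : ∀ z : ℂ, 0 < z.im → c < z.im →
      Tendsto (fun n => ∫ x, ((x : ℂ) - z)⁻¹ ∂(μ n : Measure ℝ)) F
        (𝓝 (∫ x, ((x : ℂ) - z)⁻¹ ∂(μ₀ : Measure ℝ)))) :
    Tendsto μ F (𝓝 μ₀) := by
  refine ProbabilityMeasure.tendsto_of_tight_of_separatesPoints ℂ ht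
    (separatesPoints_cauchyKernelAlgebra c) fun g hg => ?_
  have hspan : ∀ f ∈ Submodule.span ℂ (cauchyKernels c),
      Tendsto (fun n => ∫ x, f x ∂(μ n : Measure ℝ)) F (𝓝 (∫ x, f x ∂(μ₀ : Measure ℝ))) := by
    intro f hf
    induction hf using Submodule.span_induction with
    | zero => simpa using tendsto_const_nhds
    | add a b _ _ ha hb =>
      have e : ∀ ν : ProbabilityMeasure ℝ, ∫ x, (a + b) x ∂(ν : Measure ℝ) =
          ∫ x, a x ∂(ν : Measure ℝ) + ∫ x, b x ∂(ν : Measure ℝ) := fun ν =>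
        integral_add (a.integrable _) (b.integrable _)
      simp_rw [e]
      exact ha.add hb
    | smul t b _ hb =>
      have e : ∀ ν : ProbabilityMeasure ℝ, ∫ x, (t • b) x ∂(ν : Measure ℝ) =
          t • ∫ x, b x ∂(ν : Measure ℝ) := fun ν => integral_smul t _
      simp_rw [e]
      exact hb.const_smul t
    | mem a ha =>
      rcases ha with rfl | ⟨z, hz, hcz, rfl⟩
      · simpa using tendsto_const_nhds
      · simp only [cauchyKernel_apply]
        -- Closure under `star` forces kernels from both half planes; those from the lower one are
        -- handled by conjugation.
        rcases lt_or_gt_of_ne hz with hneg | hpos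
        · have h1 := h (star z) (by simpa using hneg) (by
            simpa [abs_of_neg hneg] using hcz)
          have e : ∀ ν : ProbabilityMeasure ℝ, ∫ x, ((x : ℂ) - z)⁻¹ ∂(ν : Measure ℝ) =
              (starRingEnd ℂ) (∫ x, ((x : ℂ) - star z)⁻¹ ∂(ν : Measure ℝ)) := by
            intro ν
            rw [← integral_conj]
            simp
          simp_rw [e]
          exact (Complex.continuous_conj.tendsto _).comp h1
        · exact h z hpos (by rwa [abs_of_pos hpos] at hcz)
  rw [Metric.tendsto_nhds]
  intro ε hε
  -- Integrals against probability measures move by at most the uniform distance, so an `ε / 3`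
  -- argument passes from the span to its closure.
  obtain ⟨f, hf, hfg⟩ := Metric.mem_closure_iff.mp hg (ε / 3) (by positivity)
  have hd : ∀ ν : ProbabilityMeasure ℝ,
      dist (∫ x, g x ∂(ν : Measure ℝ)) (∫ x, f x ∂(ν : Measure ℝ)) ≤ dist g f := by
    intro ν
    rw [dist_eq_norm, ← integral_sub (g.integrable _) (f.integrable _), dist_eq_norm]
    simpa using norm_integral_le_of_norm_le_const (μ := (ν : Measure ℝ))
      (Eventually.of_forall fun x => (g - f).norm_coe_le_norm x)
  filter_upwards [Metric.tendsto_nhds.mp (hspan f hf) (ε / 3) (by positivity)] with n hn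
  have h1 := hd (μ n)
  have h2 := hd μ₀
  have h3 := dist_triangle4 (∫ x, g x ∂(μ n : Measure ℝ)) (∫ x, f x ∂(μ n : Measure ℝ))
    (∫ x, f x ∂(μ₀ : Measure ℝ)) (∫ x, g x ∂(μ₀ : Measure ℝ))
  rw [dist_comm (∫ x, f x ∂(μ₀ : Measure ℝ))] at h3
  linarith

end Wigner

namespace Wigner

/-! ### The Stieltjes transform of the semicircle law -/

/-- The mean value property on the unit circle for `u ↦ (1 - q u)⁻¹`, whose value at the centre is
`1`. -/
theorem intervalIntegral_inv_one_sub_mul_exp {q : ℂ} (hq : ‖q‖ < 1) :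
    ∫ θ in (-Real.pi)..Real.pi, (1 - q * Complex.exp (θ * Complex.I))⁻¹ = 2 * Real.pi := by
  have hne : ∀ u : ℂ, ‖u‖ ≤ 1 → 1 - q * u ≠ 0 := by
    intro u hu h
    have h1 : ‖q * u‖ = 1 := by rw [← sub_eq_zero.mp h, norm_one]
    rw [norm_mul] at h1
    nlinarith [norm_nonneg q, norm_nonneg u]
  have hd : DiffContOnCl ℂ (fun u : ℂ => (1 - q * u)⁻¹) (Metric.ball 0 |1|) := by
    refine DifferentiableOn.diffContOnCl fun u hu => ?_
    have hu1 : ‖u‖ ≤ 1 := by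
      have := Metric.closure_ball_subset_closedBall hu
      simpa using this
    have := hne u hu1
    exact DifferentiableAt.differentiableWithinAt (by fun_prop (disch := assumption))
  have h := hd.circleAverage
  rw [Real.circleAverage_def] at h
  simp only [circleMap, zero_add, Complex.ofReal_one, one_mul, mul_zero, sub_zero, inv_one] at h
  have hper : Function.Periodic (fun θ : ℝ => (1 - q * Complex.exp (θ * Complex.I))⁻¹)
      (2 * Real.pi) := by
    intro θ
    have : Complex.exp (((θ + 2 * Real.pi : ℝ) : ℂ) * Complex.I) = Complex.exp (θ * Complex.I) := by
      push_cast
      rw [add_mul, Complex.exp_periodic]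
    simp only [this]
  have h2 := hper.intervalIntegral_add_eq (-Real.pi) 0
  rw [show -Real.pi + 2 * Real.pi = Real.pi by ring, zero_add] at h2
  rw [h2]
  have hpi : (2 * Real.pi : ℝ) ≠ 0 := by positivity
  rw [inv_smul_eq_iff₀ hpi] at h
  rw [h]
  simp

theorem one_sub_two_mul_cos_add_sq (q : ℂ) (θ : ℝ) :
    1 - 2 * q * Real.cos θ + q ^ 2 =
      (1 - q * Complex.exp (θ * Complex.I)) * (1 - q * Complex.exp ((-θ : ℝ) * Complex.I)) := by
  have h1 : Complex.exp (θ * Complex.I) * Complex.exp ((-θ : ℝ) * Complex.I) = 1 := by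
    rw [← Complex.exp_add]; simp
  have h2 : (2 : ℂ) * Real.cos θ =
      Complex.exp (θ * Complex.I) + Complex.exp ((-θ : ℝ) * Complex.I) := by
    rw [Complex.ofReal_cos, Complex.two_cos]; simp
  linear_combination (-q) * h2 - q ^ 2 * h1

theorem one_sub_mul_exp_ne_zero {q : ℂ} (hq : ‖q‖ < 1) (θ : ℝ) :
    1 - q * Complex.exp (θ * Complex.I) ≠ 0 := by
  intro h
  have h1 : ‖q * Complex.exp (θ * Complex.I)‖ = 1 := by rw [← sub_eq_zero.mp h, norm_one]
  rw [norm_mul, Complex.norm_exp_ofReal_mul_I, mul_one] at h1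
  linarith

theorem one_sub_two_mul_cos_add_sq_ne_zero {q : ℂ} (hq : ‖q‖ < 1) (θ : ℝ) :
    1 - 2 * q * Real.cos θ + q ^ 2 ≠ 0 := by
  rw [one_sub_two_mul_cos_add_sq]
  exact mul_ne_zero (one_sub_mul_exp_ne_zero hq θ) (one_sub_mul_exp_ne_zero hq (-θ))

/-- The Poisson integral over a half period. -/
theorem intervalIntegral_poisson {q : ℂ} (hq : ‖q‖ < 1) :
    ∫ θ in (0 : ℝ)..Real.pi, (1 - q ^ 2) / (1 - 2 * q * Real.cos θ + q ^ 2) = (Real.pi : ℂ) := by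
  set a : ℝ → ℂ := fun θ => (1 - q * Complex.exp (θ * Complex.I))⁻¹
  have hac : Continuous a := by
    refine Continuous.inv₀ (by fun_prop) (one_sub_mul_exp_ne_zero hq)
  have hi : ∀ s t : ℝ, IntervalIntegrable a volume s t := fun s t => hac.intervalIntegrable s t
  have hi' : IntervalIntegrable (fun θ => a (-θ)) volume 0 Real.pi :=
    (hac.comp continuous_neg).intervalIntegrable _ _
  -- Partial fractions in `exp (iθ)`. The terms `a θ` and `a (-θ)` unfold the half period into a
  -- full one.
  have e : ∀ θ : ℝ, (1 - q ^ 2) / (1 - 2 * q * Real.cos θ + q ^ 2) = a θ + a (-θ) - 1 := by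
    intro θ
    have h1 := one_sub_mul_exp_ne_zero hq θ
    have h2 := one_sub_mul_exp_ne_zero hq (-θ)
    have h3 : Complex.exp (θ * Complex.I) * Complex.exp ((-θ : ℝ) * Complex.I) = 1 := by
      rw [← Complex.exp_add]; simp
    rw [one_sub_two_mul_cos_add_sq]
    simp only [a]
    generalize Complex.exp (θ * Complex.I) = u at *
    generalize Complex.exp ((-θ : ℝ) * Complex.I) = v at *
    rw [div_eq_iff (mul_ne_zero h1 h2)]
    have e1 := inv_mul_cancel₀ h1
    have e2 := inv_mul_cancel₀ h2
    linear_combination q ^ 2 * h3 - (1 - q * v) * e1 - (1 - q * u) * e2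
  simp_rw [e]
  rw [intervalIntegral.integral_sub ((hi _ _).add hi') (by simp),
    intervalIntegral.integral_add (hi _ _) hi', intervalIntegral.integral_comp_neg, neg_zero,
    add_comm, intervalIntegral.integral_add_adjacent_intervals (hi _ _) (hi _ _),
    intervalIntegral_inv_one_sub_mul_exp hq]
  simp
  ring

/-- Division with remainder in `cos θ`: with `D` the denominator, `4q² sin² θ = (1 + q² + 2q cos θ)
D - (1 - q²)²`, and the remainder over `D` is a multiple of the Poisson kernel. -/
theorem intervalIntegral_sin_sq_div {q : ℂ} (hq : ‖q‖ < 1) (hq0 : q ≠ 0) :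
    ∫ θ in (0 : ℝ)..Real.pi, (Real.sin θ : ℂ) ^ 2 / (1 - 2 * q * Real.cos θ + q ^ 2)
      = (Real.pi : ℂ) / 2 := by
  have hD : ∀ θ : ℝ, 1 - 2 * q * Real.cos θ + q ^ 2 ≠ 0 := one_sub_two_mul_cos_add_sq_ne_zero hq
  have e : ∀ θ : ℝ, (Real.sin θ : ℂ) ^ 2 / (1 - 2 * q * Real.cos θ + q ^ 2) =
      (4 * q ^ 2)⁻¹ * (((1 + q ^ 2) + 2 * q * Real.cos θ) - (1 - q ^ 2) *
        ((1 - q ^ 2) / (1 - 2 * q * Real.cos θ + q ^ 2))) := by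
    intro θ
    have h3 : (Real.sin θ : ℂ) ^ 2 = 1 - (Real.cos θ : ℂ) ^ 2 := by
      rw [← Complex.ofReal_pow, Real.sin_sq]; simp
    have h4 := hD θ
    have e1 := div_mul_cancel₀ (1 - q ^ 2) h4
    rw [div_eq_iff h4, h3, mul_assoc, eq_inv_mul_iff_mul_eq₀ (by simpa using hq0)]
    linear_combination (1 - q ^ 2) * e1
  simp_rw [e]
  have hc : Continuous fun θ : ℝ => (1 - q ^ 2) / (1 - 2 * q * Real.cos θ + q ^ 2) := by
    refine Continuous.div (by fun_prop) (by fun_prop) hD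
  have hcos : ∫ θ in (0 : ℝ)..Real.pi, (Real.cos θ : ℂ) = 0 := by
    rw [intervalIntegral.integral_ofReal]
    simp
  rw [intervalIntegral.integral_const_mul, intervalIntegral.integral_sub,
    intervalIntegral.integral_add, intervalIntegral.integral_const_mul,
    intervalIntegral.integral_const_mul, intervalIntegral_poisson hq, hcos]
  · simp
    field_simp
    ring
  · simp
  · exact Continuous.intervalIntegrable (by fun_prop) _ _
  · exact Continuous.intervalIntegrable (by fun_prop) _ _
  · exact (hc.const_mul _).intervalIntegrable _ _

/-- The roots of `w q² - z q + w` have product `1`. A root on the unit circle would make `z = w (q +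
conj q)` real, so one root lies strictly inside. -/
theorem exists_joukowski {w : ℝ} (hw : 0 < w) {z : ℂ} (hz : z.im ≠ 0) :
    ∃ q : ℂ, q ≠ 0 ∧ ‖q‖ < 1 ∧ z * q = w * (1 + q ^ 2) := by
  have hw' : (w : ℂ) ≠ 0 := by exact_mod_cast hw.ne'
  obtain ⟨q, hq⟩ := exists_quadratic_eq_zero (a := (w : ℂ)) (b := -z) (c := w) hw'
    (by obtain ⟨s, hs⟩ := IsAlgClosed.exists_pow_nat_eq (discrim (w : ℂ) (-z) w) zero_lt_two
        exact ⟨s, by rw [← hs, sq]⟩)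
  have hq0 : q ≠ 0 := by rintro rfl; simp at hq; exact hw.ne' hq
  have hzq : z * q = w * (1 + q ^ 2) := by linear_combination -hq
  have h1 : ‖q‖ ≠ 1 := by
    intro h1
    apply hz
    have h2 : q * (starRingEnd ℂ) q = 1 := by rw [Complex.mul_conj, Complex.normSq_eq_norm_sq, h1]; simp
    have h3 : z = w * (q + (starRingEnd ℂ) q) := by
      apply mul_right_cancel₀ hq0
      linear_combination hzq - w * h2
    rw [h3, Complex.add_conj]
    simp
  rcases lt_or_gt_of_ne h1 with h | h
  · exact ⟨q, hq0, h, hzq⟩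
  · refine ⟨q⁻¹, inv_ne_zero hq0, by rw [norm_inv]; exact inv_lt_one_of_one_lt₀ h, ?_⟩
    field_simp
    linear_combination hzq

theorem integral_semicircleMeasure {w : ℝ} (hw : 0 < w) (f : ℝ → ℂ) :
    ∫ x, f x ∂(semicircleMeasure w) =
      ∫ x in -(2 * w)..(2 * w), (semicircleDensity w x : ℂ) * f x := by
  have hm : Measurable fun x => ENNReal.ofReal (semicircleDensity w x) := by
    unfold semicircleDensity; fun_prop
  rw [semicircleMeasure, integral_withDensity_eq_integral_toReal_smul hm (by simp),
    intervalIntegral.integral_of_le (by linarith), ← integral_indicator measurableSet_Ioc]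
  congr 1
  ext x
  rw [ENNReal.toReal_ofReal (semicircleDensity_nonneg w x)]
  by_cases hx : x ∈ Set.Ioc (-(2 * w)) (2 * w)
  · rw [Set.indicator_of_mem hx, Complex.real_smul]
  · rw [Set.indicator_of_notMem hx, semicircleDensity_eq_zero hw hx, zero_smul]

/-- The substitution `x = -2w cos θ` makes the density proportional to `sin θ` and gives `x - z =
-(w / q)(1 + 2q cos θ + q²)`, which leads to `intervalIntegral_sin_sq_div` at `-q`. -/
theorem stieltjes_semicircle_eq {w : ℝ} (hw : 0 < w) {z q : ℂ} (hz : z.im ≠ 0) (hq0 : q ≠ 0)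
    (hq : ‖q‖ < 1) (hzq : z * q = w * (1 + q ^ 2)) :
    ∫ x, ((x : ℂ) - z)⁻¹ ∂(semicircleMeasure w) = -q / w := by
  have hw' : (w : ℂ) ≠ 0 := by exact_mod_cast hw.ne'
  rw [integral_semicircleMeasure hw]
  set g : ℝ → ℂ := fun x => (semicircleDensity w x : ℂ) * ((x : ℂ) - z)⁻¹
  have hg : Continuous g := by
    refine Continuous.mul ?_ (Continuous.inv₀ (by fun_prop) ?_)
    · unfold semicircleDensity; fun_prop
    · intro x h
      apply hz
      simpa using congrArg Complex.im h
  have hder : ∀ θ ∈ Set.uIcc 0 Real.pi,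
      HasDerivAt (fun θ : ℝ => -(2 * w) * Real.cos θ) (2 * w * Real.sin θ) θ := by
    intro θ _
    have := (Real.hasDerivAt_cos θ).const_mul (-(2 * w))
    simpa [mul_assoc] using this
  have hsub := intervalIntegral.integral_deriv_smul_comp (g := g) hder (by fun_prop) hg
  simp only [Real.cos_zero, Real.cos_pi, mul_one, mul_neg, neg_neg] at hsub
  rw [← hsub]
  have e : ∀ θ ∈ Set.uIcc 0 Real.pi, (2 * w * Real.sin θ) • (g ∘ fun θ => -(2 * w) * Real.cos θ) θ =
      (-(2 * q) / (Real.pi * w)) *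
        ((Real.sin θ : ℂ) ^ 2 / (1 - 2 * (-q) * Real.cos θ + (-q) ^ 2)) := by
    intro θ hθ
    rw [Set.uIcc_of_le Real.pi_pos.le] at hθ
    have hs : 0 ≤ Real.sin θ := Real.sin_nonneg_of_mem_Icc hθ
    have hD : 1 - 2 * (-q) * Real.cos θ + (-q) ^ 2 ≠ 0 :=
      one_sub_two_mul_cos_add_sq_ne_zero (by rwa [norm_neg]) θ
    have hdens : semicircleDensity w (-(2 * w) * Real.cos θ) = (Real.pi * w)⁻¹ * Real.sin θ := by
      have e1 : 4 * w ^ 2 - (-(2 * w) * Real.cos θ) ^ 2 = (2 * w * Real.sin θ) ^ 2 := by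
        have := Real.sin_sq_add_cos_sq θ
        linear_combination (-4 * w ^ 2) * this
      rw [semicircleDensity, e1, max_eq_right (by positivity), Real.sqrt_sq (by positivity)]
      have := Real.pi_pos
      field_simp
    have e2 : (((-(2 * w) * Real.cos θ : ℝ) : ℂ) - z) =
        -(w / q) * (1 - 2 * (-q) * Real.cos θ + (-q) ^ 2) := by
      field_simp
      push_cast
      linear_combination -hzq
    have hpi : (Real.pi : ℂ) ≠ 0 := by exact_mod_cast Real.pi_ne_zero
    simp only [Function.comp, g]
    rw [hdens, e2, Complex.real_smul]
    push_cast
    field_simp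
  rw [intervalIntegral.integral_congr e, intervalIntegral.integral_const_mul,
    intervalIntegral_sin_sq_div (by rwa [norm_neg]) (neg_ne_zero.mpr hq0)]
  have hpi : (Real.pi : ℂ) ≠ 0 := by exact_mod_cast Real.pi_ne_zero
  field_simp

/-- The quadratic equation satisfied by the Stieltjes transform of the semicircle law. -/
theorem stieltjes_semicircle_quadratic {w : ℝ} (hw : 0 < w) {z : ℂ} (hz : z.im ≠ 0) :
    1 + z * (∫ x, ((x : ℂ) - z)⁻¹ ∂(semicircleMeasure w)) +
      w ^ 2 * (∫ x, ((x : ℂ) - z)⁻¹ ∂(semicircleMeasure w)) ^ 2 = 0 := by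
  obtain ⟨q, hq0, hq, hzq⟩ := exists_joukowski hw hz
  have hw' : (w : ℂ) ≠ 0 := by exact_mod_cast hw.ne'
  rw [stieltjes_semicircle_eq hw hz hq0 hq hzq]
  field_simp
  linear_combination -hzq

end Wigner

namespace Wigner

open Matrix

/-! ### The resolvent of a real symmetric matrix -/

variable {n : ℕ}

/-- The resolvent `(A - z)⁻¹` of a real matrix at a complex point. -/
noncomputable def resolventMatrix (A : Matrix (Fin n) (Fin n) ℝ) (z : ℂ) : Matrix (Fin n) (Fin n) ℂ :=
  (A.map Complex.ofReal - z • (1 : Matrix (Fin n) (Fin n) ℂ))⁻¹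

theorem map_ofReal_mul (A B : Matrix (Fin n) (Fin n) ℝ) :
    (A * B).map Complex.ofReal = A.map Complex.ofReal * B.map Complex.ofReal :=
  Matrix.map_mul (f := Complex.ofRealHom)

/-- Both facts come from one complexified real orthogonal diagonalization. The first is needed
throughout, since the matrix inverse has a default value when the determinant is not a unit. -/
theorem exists_resolvent_diagonalization {A : Matrix (Fin n) (Fin n) ℝ} (hA : A.IsHermitian) {z : ℂ}
    (hz : z.im ≠ 0) :
    (A.map Complex.ofReal - z • (1 : Matrix (Fin n) (Fin n) ℂ)) * resolventMatrix A z = 1 ∧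
      (resolventMatrix A z).trace = ∑ l, ((hA.eigenvalues l : ℂ) - z)⁻¹ := by
  set U : Matrix (Fin n) (Fin n) ℝ := hA.eigenvectorUnitary.1
  set V : Matrix (Fin n) (Fin n) ℂ := U.map Complex.ofReal
  set V' : Matrix (Fin n) (Fin n) ℂ := (star U).map Complex.ofReal
  have h1 : V * V' = 1 := by
    rw [← map_ofReal_mul, Unitary.mul_star_self_of_mem hA.eigenvectorUnitary.2]
    simp
  have h2 : V' * V = 1 := by
    rw [← map_ofReal_mul, Unitary.star_mul_self_of_mem hA.eigenvectorUnitary.2]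
    simp
  set D : Matrix (Fin n) (Fin n) ℂ := diagonal fun l => (hA.eigenvalues l : ℂ) - z
  set D' : Matrix (Fin n) (Fin n) ℂ := diagonal fun l => ((hA.eigenvalues l : ℂ) - z)⁻¹
  have hD : D * D' = 1 := by
    simp only [D, D', diagonal_mul_diagonal]
    rw [← diagonal_one]
    congr 1
    ext l
    exact mul_inv_cancel₀ (ofReal_sub_ne_zero hz _)
  have hspec : A.map Complex.ofReal - z • (1 : Matrix (Fin n) (Fin n) ℂ) = V * D * V' := by
    have e : D = (diagonal hA.eigenvalues).map Complex.ofReal - z • 1 := by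
      ext a b
      by_cases hab : a = b
      · subst hab; simp [D]
      · simp [D, hab]
    have h3 : A = U * diagonal hA.eigenvalues * star U := by
      conv_lhs => rw [hA.spectral_theorem, Unitary.conjStarAlgAut_apply]
      rfl
    rw [e, mul_sub, sub_mul, mul_smul_comm, smul_mul_assoc, mul_one, h1]
    conv_lhs => rw [h3, map_ofReal_mul, map_ofReal_mul]
  have hinv : (A.map Complex.ofReal - z • (1 : Matrix (Fin n) (Fin n) ℂ)) * (V * D' * V') = 1 := by
    rw [hspec]
    calc V * D * V' * (V * D' * V') = V * (D * (V' * V) * D') * V' := by simp only [mul_assoc]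
      _ = 1 := by rw [h2, mul_one, hD, mul_one, h1]
  have hR : resolventMatrix A z = V * D' * V' := inv_eq_right_inv hinv
  refine ⟨by rw [hR]; exact hinv, ?_⟩
  rw [hR, trace_mul_cycle, h2, one_mul, trace_diagonal]

variable {A : Matrix (Fin n) (Fin n) ℝ} {z : ℂ}

theorem isHermitian_of_isSymm (hA : A.IsSymm) : A.IsHermitian := by
  ext a b
  simp [hA.apply a b]

theorem mul_resolventMatrix (hA : A.IsSymm) (hz : z.im ≠ 0) :
    (A.map Complex.ofReal - z • (1 : Matrix (Fin n) (Fin n) ℂ)) * resolventMatrix A z = 1 :=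
  (exists_resolvent_diagonalization (isHermitian_of_isSymm hA) hz).1

theorem trace_resolventMatrix (hA : A.IsHermitian) (hz : z.im ≠ 0) :
    (resolventMatrix A z).trace = ∑ l, ((hA.eigenvalues l : ℂ) - z)⁻¹ :=
  (exists_resolvent_diagonalization hA hz).2

theorem resolventMatrix_mul (hA : A.IsSymm) (hz : z.im ≠ 0) :
    resolventMatrix A z * (A.map Complex.ofReal - z • (1 : Matrix (Fin n) (Fin n) ℂ)) = 1 :=
  mul_eq_one_comm.mp (mul_resolventMatrix hA hz)

theorem resolventMatrix_transpose (hA : A.IsSymm) (z : ℂ) :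
    (resolventMatrix A z)ᵀ = resolventMatrix A z := by
  rw [resolventMatrix, transpose_nonsing_inv, transpose_sub, transpose_smul, transpose_one,
    ← transpose_map, hA.eq]

theorem resolventMatrix_symm (hA : A.IsSymm) (z : ℂ) (a b : Fin n) :
    resolventMatrix A z a b = resolventMatrix A z b a :=
  congrFun (congrFun (resolventMatrix_transpose hA z) b) a

theorem resolventMatrix_conjTranspose (hA : A.IsSymm) (z : ℂ) :
    (resolventMatrix A z)ᴴ = resolventMatrix A (star z) := by
  rw [resolventMatrix, conjTranspose_nonsing_inv, resolventMatrix]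
  congr 1
  ext a b
  simp [hA.apply a b, one_apply, eq_comm, apply_ite (starRingEnd ℂ)]

/-- The resolvent identity. -/
theorem resolventMatrix_sub {A' : Matrix (Fin n) (Fin n) ℝ} {z' : ℂ} (hA : A.IsSymm)
    (hA' : A'.IsSymm) (hz : z.im ≠ 0) (hz' : z'.im ≠ 0) :
    resolventMatrix A z - resolventMatrix A' z' =
      resolventMatrix A z * ((A' - A).map Complex.ofReal + (z - z') • 1) *
        resolventMatrix A' z' := by
  have h1 := resolventMatrix_mul hA hz
  have h2 := mul_resolventMatrix hA' hz'
  have e : (A' - A).map Complex.ofReal + (z - z') • (1 : Matrix (Fin n) (Fin n) ℂ) =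
      (A'.map Complex.ofReal - z' • 1) - (A.map Complex.ofReal - z • 1) := by
    ext a b
    simp
    ring
  rw [e, mul_sub, sub_mul, h1, one_mul, mul_assoc, h2, mul_one]

/-- The Ward identity. -/
theorem im_resolventMatrix_diag (hA : A.IsSymm) (hz : z.im ≠ 0) (j : Fin n) :
    (resolventMatrix A z j j).im = z.im * ∑ k, ‖resolventMatrix A z j k‖ ^ 2 := by
  have hz' : (star z).im ≠ 0 := by simpa using hz
  -- The resolvent identity at `z` and `conj z` reads `G - G* = (z - conj z) G G*`.
  have h := resolventMatrix_sub hA hA hz hz'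
  rw [← resolventMatrix_conjTranspose hA, sub_self] at h
  have h2 : resolventMatrix A z j j - star (resolventMatrix A z j j) =
      (z - star z) * ∑ k, resolventMatrix A z j k * star (resolventMatrix A z j k) := by
    have h2 := congrFun (congrFun h j) j
    rw [Matrix.map_zero _ Complex.ofReal_zero, zero_add, mul_smul_comm, mul_one, smul_mul_assoc,
      Matrix.sub_apply, Matrix.smul_apply, Matrix.mul_apply, smul_eq_mul] at h2
    exact h2
  have h3 : ∀ x : ℂ, x * star x = ((‖x‖ ^ 2 : ℝ) : ℂ) := by
    intro x
    rw [Complex.star_def, Complex.mul_conj, Complex.normSq_eq_norm_sq]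
  simp_rw [h3] at h2
  rw [← Complex.ofReal_sum] at h2
  have h4 := congrArg Complex.im h2
  simp only [Complex.sub_im, Complex.star_def, Complex.conj_im, Complex.mul_im, Complex.ofReal_re,
    Complex.ofReal_im, mul_zero, zero_add, Complex.sub_re, Complex.conj_re] at h4
  linarith

/-- For a row sum `S`, the Ward identity gives `Im z · S = Im G_jj ≤ |G_jj| ≤ √S`. This row bound
takes the place of an operator norm bound. -/
theorem sum_norm_sq_resolventMatrix_le (hA : A.IsSymm) (hz : 0 < z.im) (j : Fin n) :
    ∑ k, ‖resolventMatrix A z j k‖ ^ 2 ≤ (z.im⁻¹) ^ 2 := by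
  set S := ∑ k, ‖resolventMatrix A z j k‖ ^ 2
  have hw := im_resolventMatrix_diag hA hz.ne' j
  have h1 : ‖resolventMatrix A z j j‖ ^ 2 ≤ S :=
    Finset.single_le_sum (f := fun k => ‖resolventMatrix A z j k‖ ^ 2)
      (fun _ _ => sq_nonneg _) (Finset.mem_univ j)
  have h2 : z.im * S ≤ ‖resolventMatrix A z j j‖ := by
    exact hw.symm.le.trans ((le_abs_self _).trans (Complex.abs_im_le_norm _))
  have hS : 0 ≤ S := (sq_nonneg _).trans h1
  clear_value S
  have h3 : (z.im * S) ^ 2 ≤ S := (pow_le_pow_left₀ (by positivity) h2 2).trans h1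
  rcases hS.eq_or_lt with h0 | hpos
  · rw [← h0]; positivity
  · rw [inv_pow, ← one_div, le_div_iff₀ (by positivity)]
    have : S * (S * z.im ^ 2) ≤ S * 1 := by nlinarith
    exact le_of_mul_le_mul_left this hpos

theorem norm_resolventMatrix_le (hA : A.IsSymm) (hz : 0 < z.im) (j k : Fin n) :
    ‖resolventMatrix A z j k‖ ≤ z.im⁻¹ := by
  have h1 : ‖resolventMatrix A z j k‖ ^ 2 ≤ ∑ k, ‖resolventMatrix A z j k‖ ^ 2 :=
    Finset.single_le_sum (f := fun k => ‖resolventMatrix A z j k‖ ^ 2)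
      (fun _ _ => sq_nonneg _) (Finset.mem_univ k)
  exact (sq_le_sq₀ (norm_nonneg _) (by positivity)).mp
    (h1.trans (sum_norm_sq_resolventMatrix_le hA hz j))

/-- Symmetry turns the columns of the second factor into rows; both rows are square summable with
the same bound. -/
theorem norm_resolventMatrix_mul_le {A' : Matrix (Fin n) (Fin n) ℝ} (hA : A.IsSymm)
    (hA' : A'.IsSymm) (hz : 0 < z.im) (j k : Fin n) :
    ‖(resolventMatrix A z * resolventMatrix A' z) j k‖ ≤ (z.im⁻¹) ^ 2 := by
  rw [Matrix.mul_apply]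
  have h1 : ∀ l, ‖resolventMatrix A z j l * resolventMatrix A' z l k‖ ≤
      (‖resolventMatrix A z j l‖ ^ 2 + ‖resolventMatrix A' z k l‖ ^ 2) / 2 := by
    intro l
    rw [norm_mul, resolventMatrix_symm hA' z l k]
    nlinarith [sq_nonneg (‖resolventMatrix A z j l‖ - ‖resolventMatrix A' z k l‖)]
  refine (norm_sum_le _ _).trans ((Finset.sum_le_sum fun l _ => h1 l).trans ?_)
  rw [← Finset.sum_div, Finset.sum_add_distrib]
  linarith [sum_norm_sq_resolventMatrix_le hA hz j, sum_norm_sq_resolventMatrix_le hA' hz k]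

theorem norm_trace_resolventMatrix_div_le (hA : A.IsSymm) (hz : 0 < z.im) :
    ‖(resolventMatrix A z).trace / n‖ ≤ z.im⁻¹ := by
  rw [norm_div, Complex.norm_natCast]
  refine div_le_of_le_mul₀ (by positivity) (by positivity) ?_
  rw [trace]
  refine (norm_sum_le_of_le _ fun j _ => norm_resolventMatrix_le hA hz j j).trans ?_
  simp [mul_comm]

/-- The row bound makes this sum of `n²` terms of order `n`, hence negligible after division by
`n²`. -/
theorem norm_sum_sq_resolventMatrix_le (hA : A.IsSymm) (hz : 0 < z.im) :
    ‖∑ j, ∑ k, resolventMatrix A z k j ^ 2‖ ≤ n * (z.im⁻¹) ^ 2 := by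
  have : ∀ j, ‖∑ k, resolventMatrix A z k j ^ 2‖ ≤ (z.im⁻¹) ^ 2 := by
    intro j
    refine (norm_sum_le _ _).trans (le_trans (le_of_eq ?_) (sum_norm_sq_resolventMatrix_le hA hz j))
    exact Finset.sum_congr rfl fun k _ => by rw [norm_pow, resolventMatrix_symm hA z k j]
  refine (norm_sum_le_of_le _ fun j _ => this j).trans ?_
  simp

theorem sum_entry_mul_resolventMatrix (hA : A.IsSymm) (hz : z.im ≠ 0) :
    ∑ j, ∑ k, (A j k : ℂ) * resolventMatrix A z k j = n + z * (resolventMatrix A z).trace := by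
  have h := congrArg trace (mul_resolventMatrix hA hz)
  rw [sub_mul, trace_sub, smul_mul_assoc, one_mul, trace_smul, trace_one, Fintype.card_fin] at h
  have e : (A.map Complex.ofReal * resolventMatrix A z).trace =
      ∑ j, ∑ k, (A j k : ℂ) * resolventMatrix A z k j := by
    simp [trace, Matrix.mul_apply]
  rw [e, smul_eq_mul] at h
  linear_combination h

/-! ### Perturbation of one entry -/

/-- The symmetric matrix with entries `1` at the places `(j, k)` and `(k, j)`, `0` elsewhere. -/
noncomputable def symUnit (j k : Fin n) : Matrix (Fin n) (Fin n) ℝ :=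
  (1 + if j = k then 1 else 0 : ℝ)⁻¹ • (single j k 1 + single k j 1)

/-- The matrix `A` with the entries at the places `(j, k)` and `(k, j)` replaced by `0`. -/
noncomputable def eraseEntry (A : Matrix (Fin n) (Fin n) ℝ) (j k : Fin n) : Matrix (Fin n) (Fin n) ℝ :=
  A - A j k • symUnit j k

theorem isSymm_symUnit (j k : Fin n) : (symUnit j k).IsSymm := by
  rw [Matrix.IsSymm, symUnit, transpose_smul, transpose_add, transpose_single, transpose_single,
    add_comm (single k j 1)]

theorem isSymm_eraseEntry (hA : A.IsSymm) (j k : Fin n) : (eraseEntry A j k).IsSymm :=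
  hA.sub ((isSymm_symUnit j k).smul _)

theorem eraseEntry_apply (hA : A.IsSymm) (j k a b : Fin n) :
    eraseEntry A j k a b = if (a = j ∧ b = k) ∨ (a = k ∧ b = j) then 0 else A a b := by
  have hs := hA.apply j k
  simp only [eraseEntry, symUnit, Matrix.sub_apply, Matrix.smul_apply, Matrix.add_apply,
    single_apply, smul_eq_mul]
  by_cases hjk : j = k
  · subst hjk
    by_cases h : j = a ∧ j = b
    · obtain ⟨rfl, rfl⟩ := h
      norm_num
    · have h' : ¬ (a = j ∧ b = j) := fun h' => h ⟨h'.1.symm, h'.2.symm⟩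
      simp [h, h']
  · by_cases h1 : j = a ∧ k = b
    · obtain ⟨rfl, rfl⟩ := h1
      simp [hjk, Ne.symm hjk]
    · by_cases h2 : k = a ∧ j = b
      · obtain ⟨rfl, rfl⟩ := h2
        simp [hjk, hs, Ne.symm hjk]
      · have h1' : ¬ (a = j ∧ b = k) := fun h' => h1 ⟨h'.1.symm, h'.2.symm⟩
        have h2' : ¬ (a = k ∧ b = j) := fun h' => h2 ⟨h'.1.symm, h'.2.symm⟩
        simp [h1, h2, h1', h2']

theorem inv_one_add_ite_mem (p : Prop) [Decidable p] :
    0 ≤ (1 + if p then 1 else 0 : ℝ)⁻¹ ∧ (1 + if p then 1 else 0 : ℝ)⁻¹ ≤ 1 := by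
  split_ifs <;> norm_num

theorem resolventMatrix_sub_eraseEntry (hA : A.IsSymm) (hz : z.im ≠ 0) (j k : Fin n) :
    resolventMatrix A z - resolventMatrix (eraseEntry A j k) z =
      -((A j k * (1 + if j = k then 1 else 0 : ℝ)⁻¹ : ℝ) : ℂ) •
        (resolventMatrix (eraseEntry A j k) z * (single j k 1 + single k j 1) *
          resolventMatrix A z) := by
  have h := resolventMatrix_sub (isSymm_eraseEntry hA j k) hA hz hz
  have e : (A - eraseEntry A j k).map Complex.ofReal + (z - z) • (1 : Matrix (Fin n) (Fin n) ℂ) =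
      ((A j k * (1 + if j = k then 1 else 0 : ℝ)⁻¹ : ℝ) : ℂ) •
        (single j k 1 + single k j 1 : Matrix (Fin n) (Fin n) ℂ) := by
    ext a b
    rw [sub_self, zero_smul, add_zero]
    simp only [eraseEntry, symUnit, sub_sub_cancel, Matrix.map_apply,
      Matrix.smul_apply, Matrix.add_apply, smul_eq_mul, single_apply]
    push_cast [apply_ite Complex.ofReal]
    ring
  rw [e, mul_smul_comm, smul_mul_assoc] at h
  rw [← neg_sub, h, neg_smul]

theorem resolventMatrix_sub_eraseEntry_apply (hA : A.IsSymm) (hz : z.im ≠ 0) (j k a b : Fin n) :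
    resolventMatrix A z a b - resolventMatrix (eraseEntry A j k) z a b =
      -((A j k * (1 + if j = k then 1 else 0 : ℝ)⁻¹ : ℝ) : ℂ) *
        (resolventMatrix (eraseEntry A j k) z a j * resolventMatrix A z k b +
          resolventMatrix (eraseEntry A j k) z a k * resolventMatrix A z j b) := by
  have h := congrFun (congrFun (resolventMatrix_sub_eraseEntry hA hz j k) a) b
  rw [Matrix.sub_apply, Matrix.smul_apply, smul_eq_mul] at h
  rw [h]
  congr 1
  rw [mul_add, add_mul, Matrix.add_apply]
  simp [Matrix.mul_apply, single_apply, ite_and]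

theorem norm_entry_mul_le (A : Matrix (Fin n) (Fin n) ℝ) (j k : Fin n) {t : ℂ} {r : ℝ}
    (h : ‖t‖ ≤ r) :
    ‖-((A j k * (1 + if j = k then 1 else 0 : ℝ)⁻¹ : ℝ) : ℂ) * t‖ ≤ |A j k| * r := by
  obtain ⟨h0, h1⟩ := inv_one_add_ite_mem (j = k)
  rw [norm_mul, norm_neg, Complex.norm_real, Real.norm_eq_abs, abs_mul, abs_of_nonneg h0]
  have : |A j k| * (1 + if j = k then 1 else 0 : ℝ)⁻¹ ≤ |A j k| :=
    mul_le_of_le_one_right (abs_nonneg _) h1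
  exact mul_le_mul this h (norm_nonneg _) (abs_nonneg _)

theorem norm_resolventMatrix_sub_eraseEntry_le (hA : A.IsSymm) (hz : 0 < z.im) (j k a b : Fin n) :
    ‖resolventMatrix A z a b - resolventMatrix (eraseEntry A j k) z a b‖ ≤
      2 * |A j k| * (z.im⁻¹) ^ 2 := by
  rw [resolventMatrix_sub_eraseEntry_apply hA hz.ne']
  have hb := norm_resolventMatrix_le hA hz
  have hb0 := norm_resolventMatrix_le (isSymm_eraseEntry hA j k) hz
  refine (norm_entry_mul_le A j k (r := z.im⁻¹ * z.im⁻¹ + z.im⁻¹ * z.im⁻¹) ?_).trans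
    (le_of_eq (by ring))
  refine (norm_add_le _ _).trans ?_
  rw [norm_mul, norm_mul]
  gcongr <;> first | exact hb _ _ | exact hb0 _ _

/-- Cyclicity of the trace reduces the change to two entries of a product of resolvents, so the
bound has no factor `n` and the normalized trace moves by `O(|A j k| / n)`. -/
theorem norm_trace_sub_eraseEntry_le (hA : A.IsSymm) (hz : 0 < z.im) (j k : Fin n) :
    ‖(resolventMatrix A z).trace - (resolventMatrix (eraseEntry A j k) z).trace‖ ≤
      2 * |A j k| * (z.im⁻¹) ^ 2 := by
  have h := congrArg trace (resolventMatrix_sub_eraseEntry hA hz.ne' j k)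
  rw [trace_sub, trace_smul, trace_mul_cycle, smul_eq_mul] at h
  rw [h]
  have hp := norm_resolventMatrix_mul_le hA (isSymm_eraseEntry hA j k) hz
  refine (norm_entry_mul_le A j k (r := (z.im⁻¹) ^ 2 + (z.im⁻¹) ^ 2) ?_).trans
    (le_of_eq (by ring))
  rw [mul_add, trace_add]
  refine (norm_add_le _ _).trans (add_le_add ?_ ?_)
  · simpa [trace_mul_single] using hp k j
  · simpa [trace_mul_single] using hp j k

/-- The second order remainder in the expansion of an entry of the resolvent. -/
theorem norm_resolventMatrix_remainder_le (hA : A.IsSymm) (hz : 0 < z.im) (j k : Fin n) :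
    ‖resolventMatrix A z k j - resolventMatrix (eraseEntry A j k) z k j +
      ((A j k * (1 + if j = k then 1 else 0 : ℝ)⁻¹ : ℝ) : ℂ) *
        (resolventMatrix (eraseEntry A j k) z k j ^ 2 +
          resolventMatrix (eraseEntry A j k) z k k * resolventMatrix (eraseEntry A j k) z j j)‖ ≤
      4 * |A j k| * (z.im⁻¹) ^ 2 * min (|A j k| * z.im⁻¹) 1 := by
  have hb := norm_resolventMatrix_le hA hz
  have hb0 := norm_resolventMatrix_le (isSymm_eraseEntry hA j k) hz
  have hd := norm_resolventMatrix_sub_eraseEntry_le hA hz j k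
  have hbpos : 0 ≤ z.im⁻¹ := by positivity
  rw [resolventMatrix_sub_eraseEntry_apply hA hz.ne']
  set R := resolventMatrix A z
  set R0 := resolventMatrix (eraseEntry A j k) z
  -- The first bound serves small entries; the trivial one serves large entries, where a third power
  -- of the entry would not be integrable in general.
  have hd2 : ∀ a b, ‖R a b - R0 a b‖ ≤ 2 * z.im⁻¹ * min (|A j k| * z.im⁻¹) 1 := by
    intro a b
    rw [mul_min_of_nonneg _ _ (by positivity)]
    refine le_min ((hd a b).trans (le_of_eq (by ring))) ((norm_sub_le _ _).trans ?_)
    linarith [hb a b, hb0 a b]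
  set m := min (|A j k| * z.im⁻¹) 1
  have e : -((A j k * (1 + if j = k then 1 else 0 : ℝ)⁻¹ : ℝ) : ℂ) *
        (R0 k j * R k j + R0 k k * R j j) +
      ((A j k * (1 + if j = k then 1 else 0 : ℝ)⁻¹ : ℝ) : ℂ) *
        (R0 k j ^ 2 + R0 k k * R0 j j) =
      -((A j k * (1 + if j = k then 1 else 0 : ℝ)⁻¹ : ℝ) : ℂ) *
        (R0 k j * (R k j - R0 k j) + R0 k k * (R j j - R0 j j)) := by ring
  rw [e]
  refine (norm_entry_mul_le A j k
    (r := z.im⁻¹ * (2 * z.im⁻¹ * m) + z.im⁻¹ * (2 * z.im⁻¹ * m)) ?_).trans (le_of_eq (by ring))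
  refine (norm_add_le _ _).trans ?_
  rw [norm_mul, norm_mul]
  gcongr <;> first | exact hb0 _ _ | exact hd2 _ _

/-! ### Measurability of the resolvent -/

/-- By Cramer's rule the entries are quotients of polynomials in the entries of the matrix. -/
theorem measurable_resolventMatrix_apply {Ω : Type*} [MeasurableSpace Ω]
    {M : Ω → Matrix (Fin n) (Fin n) ℝ} (hm : ∀ j k, Measurable fun ω => M ω j k) (z : ℂ)
    (j k : Fin n) : Measurable fun ω => resolventMatrix (M ω) z j k := by
  have hdet : ∀ B : Ω → Matrix (Fin n) (Fin n) ℂ, (∀ j k, Measurable fun ω => B ω j k) →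
      Measurable fun ω => (B ω).det := by
    intro B hB
    simp only [det_apply]
    exact Finset.measurable_fun_sum _ fun σ _ =>
      (Finset.measurable_fun_prod _ fun i _ => hB _ _).const_smul _
  have hB : ∀ j k, Measurable fun ω =>
      ((M ω).map Complex.ofReal - z • (1 : Matrix (Fin n) (Fin n) ℂ)) j k := by
    intro j k
    simp only [Matrix.sub_apply, Matrix.map_apply]
    exact (Complex.measurable_ofReal.comp (hm j k)).sub_const _
  simp only [resolventMatrix, inv_def, Matrix.smul_apply, smul_eq_mul, Ring.inverse_eq_inv',
    adjugate_apply]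
  refine (hdet _ hB).inv.mul (hdet _ fun a b => ?_)
  simp only [updateRow_apply]
  split_ifs
  · exact measurable_const
  · exact hB a b

end Wigner

namespace Wigner

/-! ### The self-consistent equation -/

/-! ### Deterministic expansion in one entry and the trace identity -/

section Deterministic

variable {n : ℕ} {A : Matrix (Fin n) (Fin n) ℝ} {z s : ℂ}

/-- The conjugate of the deviation from `s` of the normalized trace of the resolvent. -/
noncomputable def conjTraceDeviation (A : Matrix (Fin n) (Fin n) ℝ) (z s : ℂ) : ℂ :=
  star ((resolventMatrix A z).trace / n - s)

/-- The derivative, up to the sign, of the entry `(k, j)` of the resolvent in the direction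
`single j k 1 + single k j 1`. -/
noncomputable def resolventQuadratic (A : Matrix (Fin n) (Fin n) ℝ) (z : ℂ) (j k : Fin n) : ℂ :=
  resolventMatrix A z k j ^ 2 + resolventMatrix A z k k * resolventMatrix A z j j

theorem norm_conjTraceDeviation_le (hA : A.IsSymm) (hz : 0 < z.im) (hs : ‖s‖ ≤ z.im⁻¹) :
    ‖conjTraceDeviation A z s‖ ≤ 2 * z.im⁻¹ := by
  rw [conjTraceDeviation, norm_star]
  refine (norm_sub_le _ _).trans ?_
  linarith [norm_trace_resolventMatrix_div_le hA hz]

theorem norm_resolventQuadratic_le (hA : A.IsSymm) (hz : 0 < z.im) (j k : Fin n) :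
    ‖resolventQuadratic A z j k‖ ≤ 2 * (z.im⁻¹) ^ 2 := by
  have hb := norm_resolventMatrix_le hA hz
  rw [resolventQuadratic, two_mul]
  refine (norm_add_le _ _).trans (add_le_add ?_ ?_)
  · rw [norm_pow]
    exact pow_le_pow_left₀ (norm_nonneg _) (hb _ _) 2
  · rw [norm_mul, sq]
    exact mul_le_mul (hb _ _) (hb _ _) (norm_nonneg _) (by positivity)

theorem norm_conjTraceDeviation_sub_le (hA : A.IsSymm) (hz : 0 < z.im) (j k : Fin n) :
    ‖conjTraceDeviation A z s - conjTraceDeviation (eraseEntry A j k) z s‖ ≤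
      2 * |A j k| * (z.im⁻¹) ^ 2 / n := by
  rw [conjTraceDeviation, conjTraceDeviation, ← star_sub, norm_star, sub_sub_sub_cancel_right,
    ← sub_div, norm_div, Complex.norm_natCast]
  gcongr
  exact norm_trace_sub_eraseEntry_le hA hz j k

theorem norm_mul_sub_mul_le {a a' c c' : ℂ} {r d : ℝ} (ha : ‖a‖ ≤ r) (hc' : ‖c'‖ ≤ r)
    (h1 : ‖a - a'‖ ≤ d) (h2 : ‖c - c'‖ ≤ d) : ‖a * c - a' * c'‖ ≤ 2 * r * d := by
  have e : a * c - a' * c' = a * (c - c') + (a - a') * c' := by ring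
  have hr : 0 ≤ r := (norm_nonneg _).trans ha
  have hd : 0 ≤ d := (norm_nonneg _).trans h1
  rw [e]
  refine (norm_add_le _ _).trans ?_
  rw [norm_mul, norm_mul]
  have := mul_le_mul ha h2 (norm_nonneg _) hr
  have := mul_le_mul h1 hc' (norm_nonneg _) hd
  linarith

theorem norm_resolventQuadratic_sub_le (hA : A.IsSymm) (hz : 0 < z.im) (j k : Fin n) :
    ‖resolventQuadratic A z j k - resolventQuadratic (eraseEntry A j k) z j k‖ ≤
      8 * |A j k| * (z.im⁻¹) ^ 3 := by
  have hb := norm_resolventMatrix_le hA hz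
  have hb0 := norm_resolventMatrix_le (isSymm_eraseEntry hA j k) hz
  have hd := norm_resolventMatrix_sub_eraseEntry_le hA hz j k
  rw [resolventQuadratic, resolventQuadratic, add_sub_add_comm, sq, sq]
  refine (norm_add_le _ _).trans ((add_le_add
    (norm_mul_sub_mul_le (hb _ _) (hb0 _ _) (hd _ _) (hd _ _))
    (norm_mul_sub_mul_le (hb _ _) (hb0 _ _) (hd _ _) (hd _ _))).trans (le_of_eq (by ring)))

/-- The subtracted expression depends on the entry only through the factors `A j k` and `c (A j k)²
- v`, with `c = (1 + δ_jk)⁻¹`. Both will have mean zero and be independent of what multiplies them.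
-/
theorem norm_expansion_remainder_le (hA : A.IsSymm) (hz : 0 < z.im) (hs : ‖s‖ ≤ z.im⁻¹) {v : ℝ}
    (hv : 0 ≤ v) (j k : Fin n) :
    ‖((A j k : ℂ) * (conjTraceDeviation A z s * resolventMatrix A z k j) +
        v * (conjTraceDeviation A z s * resolventQuadratic A z j k)) -
      ((A j k : ℂ) * (conjTraceDeviation (eraseEntry A j k) z s *
          resolventMatrix (eraseEntry A j k) z k j) -
        (((1 + if j = k then 1 else 0 : ℝ)⁻¹ * A j k ^ 2 - v : ℝ) : ℂ) *
          (conjTraceDeviation (eraseEntry A j k) z s *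
            resolventQuadratic (eraseEntry A j k) z j k))‖ ≤
      2 * (z.im⁻¹) ^ 3 * A j k ^ 2 / n + 8 * (z.im⁻¹) ^ 3 * A j k ^ 2 * min (|A j k| * z.im⁻¹) 1 +
        20 * v * (z.im⁻¹) ^ 4 * |A j k| := by
  have hn : 0 < n := j.pos
  have hA0 := isSymm_eraseEntry hA j k
  have h1 := norm_resolventMatrix_le hA hz k j
  have h2 := norm_conjTraceDeviation_sub_le (s := s) hA hz j k
  have h3 := norm_conjTraceDeviation_le hA0 hz hs
  have h4 := norm_resolventMatrix_remainder_le hA hz j k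
  have h5 := norm_resolventQuadratic_sub_le hA hz j k
  have h6 := norm_resolventQuadratic_le hA hz j k
  have hbpos : 0 ≤ z.im⁻¹ := by positivity
  change ‖_ + _ * resolventQuadratic (eraseEntry A j k) z j k‖ ≤ _ at h4
  generalize conjTraceDeviation A z s = H at *
  generalize conjTraceDeviation (eraseEntry A j k) z s = H0 at *
  generalize resolventMatrix A z k j = G at *
  generalize resolventMatrix (eraseEntry A j k) z k j = G0 at *
  generalize resolventQuadratic A z j k = Q at *
  generalize resolventQuadratic (eraseEntry A j k) z j k = Q0 at *
  generalize (1 + if j = k then 1 else 0 : ℝ)⁻¹ = c at *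
  generalize A j k = x at *
  generalize z.im⁻¹ = b at *
  -- The three errors: the change of `H` in the first-order term, the second-order remainder of the
  -- resolvent entry, and the change of `H Q` in the compensating term.
  have e : ((x : ℂ) * (H * G) + v * (H * Q)) - ((x : ℂ) * (H0 * G0) -
      ((c * x ^ 2 - v : ℝ) : ℂ) * (H0 * Q0)) =
      x * ((H - H0) * G) + x * (H0 * (G - G0 + ((x * c : ℝ) : ℂ) * Q0)) +
        v * ((H - H0) * Q + H0 * (Q - Q0)) := by
    push_cast
    ring
  have hn1 : 2 * |x| * b ^ 2 / n ≤ 2 * |x| * b ^ 2 :=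
    div_le_self (by positivity) (by exact_mod_cast hn)
  rw [e]
  have hx2 : |x| * |x| = x ^ 2 := by rw [← sq, sq_abs]
  refine (norm_add₃_le).trans (add_le_add_three ?_ ?_ ?_)
  · rw [norm_mul, norm_mul, Complex.norm_real, Real.norm_eq_abs]
    calc |x| * (‖H - H0‖ * ‖G‖) ≤ |x| * (2 * |x| * b ^ 2 / n * b) := by gcongr
      _ = 2 * b ^ 3 * (|x| * |x|) / n := by ring
      _ = _ := by rw [hx2]
  · rw [norm_mul, norm_mul, Complex.norm_real, Real.norm_eq_abs]
    calc |x| * (‖H0‖ * ‖G - G0 + ((x * c : ℝ) : ℂ) * Q0‖) ≤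
        |x| * (2 * b * (4 * |x| * b ^ 2 * min (|x| * b) 1)) := by gcongr
      _ = 8 * b ^ 3 * (|x| * |x|) * min (|x| * b) 1 := by ring
      _ = _ := by rw [hx2]
  · rw [norm_mul, Complex.norm_real, Real.norm_of_nonneg hv]
    have : ‖(H - H0) * Q + H0 * (Q - Q0)‖ ≤ 20 * b ^ 4 * |x| := by
      refine (norm_add_le _ _).trans ?_
      rw [norm_mul, norm_mul]
      calc ‖H - H0‖ * ‖Q‖ + ‖H0‖ * ‖Q - Q0‖ ≤
          2 * |x| * b ^ 2 * (2 * b ^ 2) + 2 * b * (8 * |x| * b ^ 3) := by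
            gcongr
            exact h2.trans hn1
        _ = _ := by ring
    calc v * ‖(H - H0) * Q + H0 * (Q - Q0)‖ ≤ v * (20 * b ^ 4 * |x|) := by gcongr
      _ = _ := by ring

/-- An exact identity: `∑ A_jk G_kj` produces `1 + z g`, the products `G_kk G_jj` sum to `(tr G)²`
and produce `w² g²`, and the sum of squares is surplus and is removed. -/
theorem sum_expansion_eq (hA : A.IsSymm) (hz : z.im ≠ 0) (hn : n ≠ 0) (w : ℝ) :
    conjTraceDeviation A z s * (1 + z * ((resolventMatrix A z).trace / n) +
        w ^ 2 * ((resolventMatrix A z).trace / n) ^ 2) =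
      (n : ℂ)⁻¹ * ∑ j, ∑ k, ((A j k : ℂ) * (conjTraceDeviation A z s * resolventMatrix A z k j) +
        ((w ^ 2 / n : ℝ) : ℂ) * (conjTraceDeviation A z s * resolventQuadratic A z j k)) -
      ((w ^ 2 / n ^ 2 : ℝ) : ℂ) * (conjTraceDeviation A z s *
        ∑ j, ∑ k, resolventMatrix A z k j ^ 2) := by
  have h1 := sum_entry_mul_resolventMatrix hA hz
  have h2 : ∑ j, ∑ k, resolventMatrix A z k k * resolventMatrix A z j j =
      (resolventMatrix A z).trace ^ 2 := by
    rw [sq, Matrix.trace, Finset.sum_mul_sum, Finset.sum_comm]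
    rfl
  have e : ∑ j, ∑ k, ((A j k : ℂ) * (conjTraceDeviation A z s * resolventMatrix A z k j) +
        ((w ^ 2 / n : ℝ) : ℂ) * (conjTraceDeviation A z s * resolventQuadratic A z j k)) =
      conjTraceDeviation A z s * (∑ j, ∑ k, (A j k : ℂ) * resolventMatrix A z k j +
        ((w ^ 2 / n : ℝ) : ℂ) * (∑ j, ∑ k, resolventMatrix A z k j ^ 2 +
          ∑ j, ∑ k, resolventMatrix A z k k * resolventMatrix A z j j)) := by
    simp only [Finset.mul_sum, ← Finset.sum_add_distrib, resolventQuadratic]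
    refine Finset.sum_congr rfl fun j _ => Finset.sum_congr rfl fun k _ => ?_
    ring
  rw [e, h1, h2]
  have hn' : (n : ℂ) ≠ 0 := by exact_mod_cast hn
  push_cast
  field_simp
  ring

end Deterministic

/-! ### Expectation estimates for the self-consistent equation -/

section Random

variable {Ω : Type*} [MeasurableSpace Ω] {P : Measure Ω} [IsProbabilityMeasure P] {n : ℕ}
  {M : Ω → Matrix (Fin n) (Fin n) ℝ} {z s : ℂ}

theorem measurable_trace_resolventMatrix (hm : ∀ j k, Measurable fun ω => M ω j k) (z : ℂ) :
    Measurable fun ω => (resolventMatrix (M ω) z).trace := by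
  simp only [Matrix.trace, Matrix.diag]
  exact Finset.measurable_fun_sum _ fun j _ => measurable_resolventMatrix_apply hm z j j

theorem measurable_conjTraceDeviation (hm : ∀ j k, Measurable fun ω => M ω j k) (z s : ℂ) :
    Measurable fun ω => conjTraceDeviation (M ω) z s :=
  Complex.continuous_conj.measurable.comp
    (((measurable_trace_resolventMatrix hm z).div_const _).sub_const _)

theorem measurable_resolventQuadratic (hm : ∀ j k, Measurable fun ω => M ω j k) (z : ℂ)
    (j k : Fin n) : Measurable fun ω => resolventQuadratic (M ω) z j k :=
  ((measurable_resolventMatrix_apply hm z k j).pow_const 2).add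
    ((measurable_resolventMatrix_apply hm z k k).mul (measurable_resolventMatrix_apply hm z j j))

omit [IsProbabilityMeasure P] in
theorem integrable_mul_of_norm_le {f g : Ω → ℂ} (hf : Integrable f P) (hg : Measurable g) {C : ℝ}
    (hC : ∀ ω, ‖g ω‖ ≤ C) : Integrable (fun ω => f ω * g ω) P :=
  hf.mul_bdd hg.aestronglyMeasurable (Eventually.of_forall hC)

theorem norm_integral_expansion_le (hsymm : ∀ ω, (M ω).IsSymm)
    (hm : ∀ j k, Measurable fun ω => M ω j k) (hz : 0 < z.im) (hs : ‖s‖ ≤ z.im⁻¹) {v τ : ℝ}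
    (hv : 0 ≤ v) (hτ : 0 < τ) (j k : Fin n) (hL2 : MemLp (fun ω => M ω j k) 2 P)
    (hmean : ∫ ω, M ω j k ∂P = 0)
    (hvar : ∫ ω, M ω j k ^ 2 ∂P = (1 + if j = k then 1 else 0) * v)
    (hind : IndepFun (fun ω => M ω j k) (fun ω (a b : Fin n) => eraseEntry (M ω) j k a b) P) :
    ‖∫ ω, ((M ω j k : ℂ) * (conjTraceDeviation (M ω) z s * resolventMatrix (M ω) z k j) +
        v * (conjTraceDeviation (M ω) z s * resolventQuadratic (M ω) z j k)) ∂P‖ ≤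
      4 * (z.im⁻¹) ^ 3 * v / n + 8 * (z.im⁻¹) ^ 3 * (2 * z.im⁻¹ * τ * v +
        ∫ ω in {ω | τ < |M ω j k|}, M ω j k ^ 2 ∂P) +
        20 * v * (z.im⁻¹) ^ 4 * (τ + 2 * v / τ) := by
  have hbpos : 0 ≤ z.im⁻¹ := by positivity
  set b := z.im⁻¹
  set X : Ω → ℝ := fun ω => M ω j k
  have hXm : Measurable X := hm j k
  have hM0 : ∀ ω, (eraseEntry (M ω) j k).IsSymm := fun ω => isSymm_eraseEntry (hsymm ω) j k
  have hm0 : ∀ a c, Measurable fun ω => eraseEntry (M ω) j k a c := fun a c =>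
    (hm a c).sub ((hm j k).mul_const _)
  have hX1 : Integrable X P := hL2.integrable one_le_two
  have hX2 : Integrable (fun ω => X ω ^ 2) P := hL2.integrable_sq
  have hH : ∀ ω, ‖conjTraceDeviation (M ω) z s‖ ≤ 2 * b := fun ω =>
    norm_conjTraceDeviation_le (hsymm ω) hz hs
  have hH0 : ∀ ω, ‖conjTraceDeviation (eraseEntry (M ω) j k) z s‖ ≤ 2 * b := fun ω =>
    norm_conjTraceDeviation_le (hM0 ω) hz hs
  have hprod : ∀ {p q : ℂ} {r t : ℝ}, ‖p‖ ≤ r → ‖q‖ ≤ t → ‖p * q‖ ≤ r * t := by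
    intro p q r t hp hq
    rw [norm_mul]
    exact mul_le_mul hp hq (norm_nonneg _) ((norm_nonneg _).trans hp)
  have hX1c : Integrable (fun ω => (X ω : ℂ)) P := hX1.ofReal
  -- The variance is `2v` on the diagonal and `v` off it; the factor `c` makes the mean of `c X²`
  -- equal to `v` in both cases.
  set c : ℝ := (1 + if j = k then 1 else 0 : ℝ)⁻¹
  have hcv : Integrable (fun ω => c * X ω ^ 2 - v) P := (hX2.const_mul c).sub (integrable_const v)
  have hcvc : Integrable (fun ω => ((c * X ω ^ 2 - v : ℝ) : ℂ)) P := hcv.ofReal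
  have hcv0 : ∫ ω, (c * X ω ^ 2 - v) ∂P = 0 := by
    rw [integral_sub (hX2.const_mul c) (integrable_const v), integral_const_mul, hvar]
    have : (1 + if j = k then 1 else 0 : ℝ) ≠ 0 := by split_ifs <;> norm_num
    simp only [c, integral_const, probReal_univ, one_smul]
    field_simp
    ring
  have i1 := integrable_mul_of_norm_le hX1c
    ((measurable_conjTraceDeviation hm z s).mul (measurable_resolventMatrix_apply hm z k j))
    (fun ω => hprod (hH ω) (norm_resolventMatrix_le (hsymm ω) hz k j))
  have i2 := integrable_mul_of_norm_le (integrable_const (v : ℂ) : Integrable (fun _ => (v : ℂ)) P)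
    ((measurable_conjTraceDeviation hm z s).mul (measurable_resolventQuadratic hm z j k))
    (fun ω => hprod (hH ω) (norm_resolventQuadratic_le (hsymm ω) hz j k))
  have i3 := integrable_mul_of_norm_le hX1c
    ((measurable_conjTraceDeviation hm0 z s).mul (measurable_resolventMatrix_apply hm0 z k j))
    (fun ω => hprod (hH0 ω) (norm_resolventMatrix_le (hM0 ω) hz k j))
  have i4 := integrable_mul_of_norm_le hcvc
    ((measurable_conjTraceDeviation hm0 z s).mul (measurable_resolventQuadratic hm0 z j k))
    (fun ω => hprod (hH0 ω) (norm_resolventQuadratic_le (hM0 ω) hz j k))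
  have hid : ∀ a c, Measurable fun B : Fin n → Fin n → ℝ => Matrix.of B a c := fun a c =>
    (measurable_pi_apply c).comp (measurable_pi_apply a)
  have hmY : Measurable fun ω (a c : Fin n) => eraseEntry (M ω) j k a c :=
    measurable_pi_lambda _ fun a => measurable_pi_lambda _ fun c => hm0 a c
  -- Independence of the entry from the erased matrix factors both comparison integrals, and the
  -- factor from the entry has mean zero.
  have z3 := hind.integral_fun_comp_mul_comp (f := fun x : ℝ => (x : ℂ))
    (g := fun B : Fin n → Fin n → ℝ => conjTraceDeviation (Matrix.of B) z s *
      resolventMatrix (Matrix.of B) z k j) hXm.aemeasurable hmY.aemeasurable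
    Complex.measurable_ofReal.aestronglyMeasurable ((measurable_conjTraceDeviation hid z s).mul
      (measurable_resolventMatrix_apply hid z k j)).aestronglyMeasurable
  have z4 := hind.integral_fun_comp_mul_comp (f := fun x : ℝ => ((c * x ^ 2 - v : ℝ) : ℂ))
    (g := fun B : Fin n → Fin n → ℝ => conjTraceDeviation (Matrix.of B) z s *
      resolventQuadratic (Matrix.of B) z j k) hXm.aemeasurable hmY.aemeasurable
    (Measurable.aestronglyMeasurable (by fun_prop)) ((measurable_conjTraceDeviation hid z s).mul
      (measurable_resolventQuadratic hid z j k)).aestronglyMeasurable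
  rw [integral_complex_ofReal, hmean, Complex.ofReal_zero, zero_mul] at z3
  rw [integral_complex_ofReal, hcv0, Complex.ofReal_zero, zero_mul] at z4
  have hmain := integral_sub (i1.add i2) (i3.sub i4)
  have h34 := integral_sub i3 i4
  have e34 : ∫ ω, ((X ω : ℂ) * (conjTraceDeviation (eraseEntry (M ω) j k) z s *
          resolventMatrix (eraseEntry (M ω) j k) z k j) -
        ((c * X ω ^ 2 - v : ℝ) : ℂ) * (conjTraceDeviation (eraseEntry (M ω) j k) z s *
            resolventQuadratic (eraseEntry (M ω) j k) z j k)) ∂P = 0 := by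
    refine h34.trans ?_
    rw [sub_eq_zero]
    exact z3.trans z4.symm
  have hsub := hmain.trans (congrArg _ e34)
  rw [sub_zero] at hsub
  refine (congrArg norm hsub.symm).le.trans ?_
  have hsm : MeasurableSet {ω | τ < |X ω|} := measurableSet_lt measurable_const hXm.abs
  set ind : Ω → ℝ := {ω | τ < |X ω|}.indicator fun ω => X ω ^ 2
  have hind_int : Integrable ind P := hX2.indicator hsm
  have hbound : ∀ ω, 2 * b ^ 3 * X ω ^ 2 / n + 8 * b ^ 3 * X ω ^ 2 * min (|X ω| * b) 1 +
        20 * v * b ^ 4 * |X ω| ≤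
      2 * b ^ 3 / n * X ω ^ 2 + 8 * b ^ 3 * (b * τ * X ω ^ 2 + ind ω) +
        20 * v * b ^ 4 * (τ + X ω ^ 2 / τ) := by
    intro ω
    -- Below `τ` the minimum is at most `τ b`; above `τ` it is at most `1`, which leaves the
    -- truncated second moment.
    have h1 : X ω ^ 2 * min (|X ω| * b) 1 ≤ b * τ * X ω ^ 2 + ind ω := by
      by_cases h : τ < |X ω|
      · have : ind ω = X ω ^ 2 := Set.indicator_of_mem (s := {ω | τ < |X ω|}) h _
        rw [this]
        have : X ω ^ 2 * min (|X ω| * b) 1 ≤ X ω ^ 2 * 1 := by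
          gcongr
          exact min_le_right _ _
        have : 0 ≤ b * τ * X ω ^ 2 := by positivity
        linarith
      · have : ind ω = 0 := Set.indicator_of_notMem (s := {ω | τ < |X ω|}) h _
        rw [this, add_zero]
        calc X ω ^ 2 * min (|X ω| * b) 1 ≤ X ω ^ 2 * (τ * b) := by
              gcongr
              exact (min_le_left _ _).trans (by gcongr; exact not_lt.mp h)
          _ = _ := by ring
    -- With `v = w² / n`, after summation over the `n²` entries and division by `n`, this bound
    -- costs `O(τ) + O(1 / (n τ))`.
    have h2 : |X ω| ≤ τ + X ω ^ 2 / τ := by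
      rw [← sq_abs (X ω)]
      by_cases h : |X ω| ≤ τ
      · have : 0 ≤ |X ω| ^ 2 / τ := by positivity
        linarith
      · have : |X ω| ≤ |X ω| ^ 2 / τ := by
          rw [le_div_iff₀ hτ, sq]
          exact mul_le_mul_of_nonneg_left (not_le.mp h).le (abs_nonneg _)
        linarith
    have h3 : 8 * b ^ 3 * X ω ^ 2 * min (|X ω| * b) 1 ≤
        8 * b ^ 3 * (b * τ * X ω ^ 2 + ind ω) := by
      rw [mul_assoc]
      gcongr
    have h4 : 20 * v * b ^ 4 * |X ω| ≤ 20 * v * b ^ 4 * (τ + X ω ^ 2 / τ) := by gcongr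
    have h5 : 2 * b ^ 3 * X ω ^ 2 / n = 2 * b ^ 3 / n * X ω ^ 2 := by ring
    linarith
  have j1 : Integrable (fun ω => 2 * b ^ 3 / n * X ω ^ 2) P := hX2.const_mul _
  have j2' : Integrable (fun ω => b * τ * X ω ^ 2 + ind ω) P := (hX2.const_mul _).add hind_int
  have j2 : Integrable (fun ω => 8 * b ^ 3 * (b * τ * X ω ^ 2 + ind ω)) P := j2'.const_mul _
  have j3' : Integrable (fun ω => τ + X ω ^ 2 / τ) P := (integrable_const τ).add (hX2.div_const τ)
  have j3 : Integrable (fun ω => 20 * v * b ^ 4 * (τ + X ω ^ 2 / τ)) P := j3'.const_mul _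
  refine (norm_integral_le_of_norm_le ((j1.add j2).add j3) (Eventually.of_forall fun ω =>
    (norm_expansion_remainder_le (hsymm ω) hz hs hv j k).trans (hbound ω))).trans ?_
  have hvar2 : ∫ ω, X ω ^ 2 ∂P ≤ 2 * v := by
    rw [hvar]
    split_ifs <;> linarith
  have hI : ∫ ω, (2 * b ^ 3 / n * X ω ^ 2 + 8 * b ^ 3 * (b * τ * X ω ^ 2 + ind ω) +
        20 * v * b ^ 4 * (τ + X ω ^ 2 / τ)) ∂P =
      2 * b ^ 3 / n * ∫ ω, X ω ^ 2 ∂P + 8 * b ^ 3 * (b * τ * ∫ ω, X ω ^ 2 ∂P + ∫ ω, ind ω ∂P) +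
        20 * v * b ^ 4 * (τ + (∫ ω, X ω ^ 2 ∂P) / τ) := by
    have j12 : Integrable (fun ω => 2 * b ^ 3 / n * X ω ^ 2 +
        8 * b ^ 3 * (b * τ * X ω ^ 2 + ind ω)) P := j1.add j2
    rw [integral_add j12 j3, integral_add j1 j2, integral_const_mul, integral_const_mul,
      integral_const_mul, integral_add (hX2.const_mul _) hind_int, integral_const_mul,
      integral_add (integrable_const τ) (hX2.div_const τ), integral_div]
    simp
  refine hI.le.trans ?_
  rw [integral_indicator hsm]
  calc _ ≤ 2 * b ^ 3 / n * (2 * v) + 8 * b ^ 3 * (b * τ * (2 * v) +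
        ∫ ω in {ω | τ < |X ω|}, X ω ^ 2 ∂P) + 20 * v * b ^ 4 * (τ + 2 * v / τ) := by gcongr
    _ = _ := by ring

theorem norm_integral_selfConsistent_le (hn : n ≠ 0) (hsymm : ∀ ω, (M ω).IsSymm)
    (hm : ∀ j k, Measurable fun ω => M ω j k) (hz : 0 < z.im) (hs : ‖s‖ ≤ z.im⁻¹) {w τ : ℝ}
    (hτ : 0 < τ) (hL2 : ∀ j k, MemLp (fun ω => M ω j k) 2 P)
    (hmean : ∀ j k, ∫ ω, M ω j k ∂P = 0)
    (hvar : ∀ j k, ∫ ω, M ω j k ^ 2 ∂P = (1 + if j = k then 1 else 0) * (w ^ 2 / n))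
    (hind : ∀ j k, IndepFun (fun ω => M ω j k)
      (fun ω (a b : Fin n) => eraseEntry (M ω) j k a b) P) :
    ‖∫ ω, conjTraceDeviation (M ω) z s * (1 + z * ((resolventMatrix (M ω) z).trace / n) +
        w ^ 2 * ((resolventMatrix (M ω) z).trace / n) ^ 2) ∂P‖ ≤
      6 * (z.im⁻¹) ^ 3 * w ^ 2 / n + 36 * (z.im⁻¹) ^ 4 * w ^ 2 * τ +
        40 * (z.im⁻¹) ^ 4 * w ^ 4 / τ / n +
        8 * (z.im⁻¹) ^ 3 * ((n : ℝ)⁻¹ *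
          ∑ j, ∑ k, ∫ ω in {ω | τ < |M ω j k|}, M ω j k ^ 2 ∂P) := by
  have hbpos : 0 ≤ z.im⁻¹ := by positivity
  have hn' : (0 : ℝ) < n := by exact_mod_cast Nat.pos_of_ne_zero hn
  have hT := fun j k => norm_integral_expansion_le hsymm hm hz hs (v := w ^ 2 / n) (by positivity)
    hτ j k (hL2 j k) (hmean j k) (hvar j k) (hind j k)
  have hH := fun ω => norm_conjTraceDeviation_le (hsymm ω) hz hs
  have hHm := measurable_conjTraceDeviation hm z s
  set b := z.im⁻¹
  have hprod : ∀ {p q : ℂ} {r t : ℝ}, ‖p‖ ≤ r → ‖q‖ ≤ t → ‖p * q‖ ≤ r * t := by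
    intro p q r t hp hq
    rw [norm_mul]
    exact mul_le_mul hp hq (norm_nonneg _) ((norm_nonneg _).trans hp)
  have hi : ∀ j k, Integrable (fun ω => (M ω j k : ℂ) * (conjTraceDeviation (M ω) z s *
      resolventMatrix (M ω) z k j) + ((w ^ 2 / n : ℝ) : ℂ) * (conjTraceDeviation (M ω) z s *
        resolventQuadratic (M ω) z j k)) P := fun j k =>
    (integrable_mul_of_norm_le ((hL2 j k).integrable one_le_two).ofReal
      (hHm.mul (measurable_resolventMatrix_apply hm z k j))
      (fun ω => hprod (hH ω) (norm_resolventMatrix_le (hsymm ω) hz k j))).add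
    (integrable_mul_of_norm_le (integrable_const _)
      (hHm.mul (measurable_resolventQuadratic hm z j k))
      (fun ω => hprod (hH ω) (norm_resolventQuadratic_le (hsymm ω) hz j k)))
  have hi2 : Integrable (fun ω => ((w ^ 2 / n ^ 2 : ℝ) : ℂ) * (conjTraceDeviation (M ω) z s *
        ∑ j, ∑ k, resolventMatrix (M ω) z k j ^ 2)) P :=
    integrable_mul_of_norm_le (integrable_const _) (hHm.mul (Finset.measurable_fun_sum _ fun j _ =>
      Finset.measurable_fun_sum _ fun k _ => (measurable_resolventMatrix_apply hm z k j).pow_const 2))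
      (fun ω => hprod (hH ω) (norm_sum_sq_resolventMatrix_le (hsymm ω) hz))
  simp_rw [fun ω => sum_expansion_eq (s := s) (hsymm ω) hz.ne' hn w]
  have hsum : ∀ j, Integrable (fun ω => ∑ k, ((M ω j k : ℂ) * (conjTraceDeviation (M ω) z s *
      resolventMatrix (M ω) z k j) + ((w ^ 2 / n : ℝ) : ℂ) * (conjTraceDeviation (M ω) z s *
        resolventQuadratic (M ω) z j k))) P := fun j => integrable_finsetSum _ fun k _ => hi j k
  rw [integral_sub ((integrable_finsetSum _ fun j _ => hsum j).const_mul _) hi2,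
    integral_const_mul, integral_finsetSum _ fun j _ => hsum j]
  simp_rw [fun j => integral_finsetSum _ fun k (_ : k ∈ Finset.univ) => hi j k]
  refine (norm_sub_le _ _).trans ?_
  have hB : ‖∫ ω, ((w ^ 2 / n ^ 2 : ℝ) : ℂ) * (conjTraceDeviation (M ω) z s *
      ∑ j, ∑ k, resolventMatrix (M ω) z k j ^ 2) ∂P‖ ≤ w ^ 2 / n ^ 2 * (2 * b * (n * b ^ 2)) := by
    refine (norm_integral_le_of_norm_le_const (Eventually.of_forall fun ω =>
      hprod (r := w ^ 2 / n ^ 2) ?_ (hprod (hH ω)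
        (norm_sum_sq_resolventMatrix_le (hsymm ω) hz)))).trans (by simp [b])
    rw [Complex.norm_real, Real.norm_of_nonneg (by positivity)]
  rw [norm_mul, norm_inv, Complex.norm_natCast]
  have hA := norm_sum_le_of_le Finset.univ fun j (_ : j ∈ Finset.univ) =>
    norm_sum_le_of_le Finset.univ fun k (_ : k ∈ Finset.univ) => hT j k
  -- In the constants, `6 = 4 + 2`, the `2` coming from the surplus sum of squares, and `36 = 16 +
  -- 20`, from the truncation and from the linear term.
  refine (add_le_add (mul_le_mul_of_nonneg_left hA (by positivity)) hB).trans (le_of_eq ?_)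
  simp only [Finset.sum_add_distrib, ← Finset.mul_sum, Finset.sum_const, Finset.card_univ,
    Fintype.card_fin, nsmul_eq_mul]
  field_simp
  ring

/-- The normalized trace of the resolvent is close in the mean square to the solution of the
quadratic equation of the semicircle law. -/
theorem integral_norm_sq_sub_le (hsymm : ∀ ω, (M ω).IsSymm)
    (hm : ∀ j k, Measurable fun ω => M ω j k) (hz : 0 < z.im) (hs : ‖s‖ ≤ z.im⁻¹) {w : ℝ}
    (hs' : 1 + z * s + w ^ 2 * s ^ 2 = 0) :
    (z.im - 2 * w ^ 2 * z.im⁻¹) * ∫ ω, ‖(resolventMatrix (M ω) z).trace / n - s‖ ^ 2 ∂P ≤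
      ‖∫ ω, conjTraceDeviation (M ω) z s * (1 + z * ((resolventMatrix (M ω) z).trace / n) +
        w ^ 2 * ((resolventMatrix (M ω) z).trace / n) ^ 2) ∂P‖ := by
  have hg := fun ω => norm_trace_resolventMatrix_div_le (hsymm ω) hz
  have hgm : Measurable fun ω => (resolventMatrix (M ω) z).trace / n :=
    (measurable_trace_resolventMatrix hm z).div_const _
  have e : ∀ ω, conjTraceDeviation (M ω) z s * (1 + z * ((resolventMatrix (M ω) z).trace / n) +
        w ^ 2 * ((resolventMatrix (M ω) z).trace / n) ^ 2) =
      ((‖(resolventMatrix (M ω) z).trace / n - s‖ ^ 2 : ℝ) : ℂ) *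
        (z + w ^ 2 * ((resolventMatrix (M ω) z).trace / n + s)) := by
    intro ω
    have h1 := Complex.mul_conj ((resolventMatrix (M ω) z).trace / n - s)
    rw [Complex.normSq_eq_norm_sq] at h1
    rw [← h1, conjTraceDeviation, Complex.star_def]
    -- Subtracting the equation of `s` leaves a multiple of `g - s`, which pairs with its conjugate.
    linear_combination (starRingEnd ℂ ((resolventMatrix (M ω) z).trace / n - s)) * hs'
  have hsq : Integrable (fun ω => ‖(resolventMatrix (M ω) z).trace / n - s‖ ^ 2) P := by
    refine Integrable.of_bound ((hgm.sub_const s).norm.pow_const 2).aestronglyMeasurable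
      ((2 * z.im⁻¹) ^ 2) (Eventually.of_forall fun ω => ?_)
    rw [norm_pow, norm_norm]
    refine pow_le_pow_left₀ (norm_nonneg _) ((norm_sub_le _ _).trans ?_) 2
    linarith [hg ω]
  have him : ∀ ω, z.im - 2 * w ^ 2 * z.im⁻¹ ≤
      (z + w ^ 2 * ((resolventMatrix (M ω) z).trace / n + s)).im := by
    intro ω
    have h1 : ‖(w : ℂ) ^ 2 * ((resolventMatrix (M ω) z).trace / n + s)‖ ≤
        w ^ 2 * (2 * z.im⁻¹) := by
      rw [norm_mul, norm_pow, Complex.norm_real, Real.norm_eq_abs, sq_abs]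
      gcongr
      refine (norm_add_le _ _).trans ?_
      linarith [hg ω]
    have h2 := (Complex.abs_im_le_norm _).trans h1
    rw [Complex.add_im]
    linarith [neg_abs_le ((w : ℂ) ^ 2 * ((resolventMatrix (M ω) z).trace / n + s)).im]
  have hint : Integrable (fun ω => ((‖(resolventMatrix (M ω) z).trace / n - s‖ ^ 2 : ℝ) : ℂ) *
        (z + w ^ 2 * ((resolventMatrix (M ω) z).trace / n + s))) P := by
    refine integrable_mul_of_norm_le hsq.ofReal (((hgm.add_const s).const_mul _).const_add _)
      (C := ‖z‖ + w ^ 2 * (2 * z.im⁻¹)) fun ω => (norm_add_le _ _).trans ?_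
    gcongr
    rw [norm_mul, norm_pow, Complex.norm_real, Real.norm_eq_abs, sq_abs]
    gcongr
    refine (norm_add_le _ _).trans ?_
    linarith [hg ω]
  simp_rw [e]
  refine le_trans ?_ ((le_abs_self _).trans (Complex.abs_im_le_norm _))
  have h1 : (∫ ω, ((‖(resolventMatrix (M ω) z).trace / n - s‖ ^ 2 : ℝ) : ℂ) *
        (z + w ^ 2 * ((resolventMatrix (M ω) z).trace / n + s)) ∂P).im =
      ∫ ω, ‖(resolventMatrix (M ω) z).trace / n - s‖ ^ 2 *
        (z + w ^ 2 * ((resolventMatrix (M ω) z).trace / n + s)).im ∂P := by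
    have := integral_im hint
    simp only [RCLike.im_to_complex, Complex.im_ofReal_mul] at this
    exact this.symm
  rw [h1, ← integral_const_mul]
  refine integral_mono (hsq.const_mul _) ?_ fun ω => ?_
  · have := hint.im
    simpa only [RCLike.im_to_complex, Complex.im_ofReal_mul] using this
  · simp only
    rw [mul_comm]
    exact mul_le_mul_of_nonneg_left (him ω) (sq_nonneg _)

end Random

end Wigner

namespace Wigner

/-! ### Integrals with respect to the expected counting measure -/

section Integrals

variable {Ω : Type*} [MeasurableSpace Ω] {P : Measure Ω} {n : ℕ} [NeZero n]
  {M : Ω → Matrix (Fin n) (Fin n) ℝ}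

omit [NeZero n] in
theorem integral_countingMeasure {A : Matrix (Fin n) (Fin n) ℝ} (hA : A.IsHermitian) (f : ℝ → ℂ) :
    ∫ x, f x ∂(countingMeasure hA) = (∑ l, f (hA.eigenvalues l)) / n := by
  rw [countingMeasure, integral_smul_measure,
    integral_finsetSum_measure fun l _ => integrable_dirac (by simp)]
  simp [div_eq_inv_mul]

omit [NeZero n] in
theorem lintegral_countingMeasure {A : Matrix (Fin n) (Fin n) ℝ} (hA : A.IsHermitian)
    {f : ℝ → ENNReal} (hf : Measurable f) :
    ∫⁻ x, f x ∂(countingMeasure hA) = (n : ENNReal)⁻¹ * ∑ l, f (hA.eigenvalues l) := by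
  rw [countingMeasure, lintegral_smul_measure, lintegral_finsetSum_measure, smul_eq_mul]
  simp_rw [lintegral_dirac' _ hf]

theorem integral_expectedCountingMeasure [IsProbabilityMeasure P]
    (hm : ∀ j k, Measurable fun ω => M ω j k) (hM : ∀ ω, (M ω).IsHermitian) {f : ℝ → ℂ}
    (hf : Integrable f (expectedCountingMeasure P M hM)) :
    ∫ x, f x ∂(expectedCountingMeasure P M hM) =
      ∫ ω, (∑ l, f ((hM ω).eigenvalues l)) / n ∂P := by
  -- Viewing the mixture as a composition of kernels gives the Fubini formula for it.
  set η : Kernel Ω ℝ := ⟨fun ω => countingMeasure (hM ω), measurable_countingMeasure hm hM⟩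
  have e : expectedCountingMeasure P M hM = (η ∘ₖ Kernel.const Unit P) () := by
    rw [Kernel.comp_apply, Kernel.const_apply]
    rfl
  rw [e] at hf ⊢
  rw [Kernel.integral_comp hf, Kernel.const_apply]
  exact integral_congr_ae (Eventually.of_forall fun ω => integral_countingMeasure (hM ω) f)

theorem integral_stieltjes_expectedCountingMeasure [IsProbabilityMeasure P]
    (hm : ∀ j k, Measurable fun ω => M ω j k) (hM : ∀ ω, (M ω).IsHermitian) {z : ℂ}
    (hz : z.im ≠ 0) :
    ∫ x, ((x : ℂ) - z)⁻¹ ∂(expectedCountingMeasure P M hM) =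
      ∫ ω, (resolventMatrix (M ω) z).trace / n ∂P := by
  have := isProbabilityMeasure_expectedCountingMeasure P hm hM
  have hi : Integrable (fun x : ℝ => ((x : ℂ) - z)⁻¹) (expectedCountingMeasure P M hM) :=
    (cauchyKernel z hz).integrable _
  rw [integral_expectedCountingMeasure hm hM hi]
  simp_rw [fun ω => trace_resolventMatrix (hM ω) hz]

omit [NeZero n] in
-- Both sides are the trace of `A²`; this supplies the second moment used for tightness.
theorem sum_sq_eigenvalues {A : Matrix (Fin n) (Fin n) ℝ} (hA : A.IsHermitian) :
    ∑ l, hA.eigenvalues l ^ 2 = ∑ j, ∑ k, A j k ^ 2 := by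
  have h := trace_aeval_eq_sum hA (Polynomial.X ^ 2)
  simp only [map_pow, Polynomial.aeval_X, Polynomial.eval_pow, Polynomial.eval_X] at h
  rw [← h, sq, Matrix.trace]
  refine Finset.sum_congr rfl fun j _ => ?_
  rw [Matrix.diag_apply, Matrix.mul_apply]
  refine Finset.sum_congr rfl fun k _ => ?_
  have := hA.apply j k
  rw [star_trivial] at this
  rw [sq, this]

theorem lintegral_sq_expectedCountingMeasure (hm : ∀ j k, Measurable fun ω => M ω j k)
    (hM : ∀ ω, (M ω).IsHermitian) (hL2 : ∀ j k, MemLp (fun ω => M ω j k) 2 P) :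
    ∫⁻ x, ENNReal.ofReal (x ^ 2) ∂(expectedCountingMeasure P M hM) =
      ENNReal.ofReal ((n : ℝ)⁻¹ * ∑ j, ∑ k, ∫ ω, M ω j k ^ 2 ∂P) := by
  have hf : Measurable fun x : ℝ => ENNReal.ofReal (x ^ 2) := by fun_prop
  have hn : (0 : ℝ) < n := by exact_mod_cast Nat.pos_of_ne_zero (NeZero.ne n)
  rw [expectedCountingMeasure, Measure.lintegral_bind
    (measurable_countingMeasure hm hM).aemeasurable hf.aemeasurable]
  have e : ∀ ω, ∫⁻ x, ENNReal.ofReal (x ^ 2) ∂(countingMeasure (hM ω)) =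
      ENNReal.ofReal ((n : ℝ)⁻¹ * ∑ j, ∑ k, M ω j k ^ 2) := by
    intro ω
    rw [lintegral_countingMeasure (hM ω) hf, ← sum_sq_eigenvalues (hM ω),
      ENNReal.ofReal_mul (by positivity), ENNReal.ofReal_inv_of_pos hn, ENNReal.ofReal_natCast,
      ENNReal.ofReal_sum_of_nonneg fun _ _ => sq_nonneg _]
  simp_rw [e]
  have hi : ∀ j, Integrable (fun ω => ∑ k, M ω j k ^ 2) P := fun j =>
    integrable_finsetSum _ fun k _ => (hL2 j k).integrable_sq
  rw [← ofReal_integral_eq_lintegral_ofReal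
    ((integrable_finsetSum _ fun j _ => hi j).const_mul _)
    (Eventually.of_forall fun ω => by positivity), integral_const_mul,
    integral_finsetSum _ fun j _ => hi j]
  simp_rw [fun j => integral_finsetSum _ fun k (_ : k ∈ Finset.univ) => (hL2 j k).integrable_sq]

end Integrals

/-! ### Normalized Wigner matrices -/

theorem isTightMeasureSet_of_lintegral_sq_le {S : Set (Measure ℝ)} {C : ENNReal} (hC : C ≠ ⊤)
    (h : ∀ μ ∈ S, ∫⁻ x, ENNReal.ofReal (x ^ 2) ∂μ ≤ C) : IsTightMeasureSet S := by
  refine isTightMeasureSet_of_tendsto_measure_norm_gt ?_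
  have h0 : Tendsto (fun r : ℝ => C / ENNReal.ofReal (r ^ 2)) atTop (𝓝 0) := by
    have h1 : Tendsto (fun r : ℝ => ENNReal.ofReal (r ^ 2)) atTop (𝓝 ⊤) :=
      ENNReal.tendsto_ofReal_nhds_top.mpr (tendsto_pow_atTop two_ne_zero)
    have := ENNReal.Tendsto.const_div h1 (a := C) (Or.inr hC)
    simpa using this
  refine tendsto_of_tendsto_of_tendsto_of_le_of_le' tendsto_const_nhds h0
    (Eventually.of_forall fun _ => zero_le) ?_
  filter_upwards [eventually_gt_atTop 0] with r hr
  refine iSup₂_le fun μ hμ => ?_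
  have hsub : {x : ℝ | r < ‖x‖} ⊆ {x | ENNReal.ofReal (r ^ 2) ≤ ENNReal.ofReal (x ^ 2)} := by
    intro x hx
    refine ENNReal.ofReal_le_ofReal ?_
    rw [← sq_abs x]
    exact pow_le_pow_left₀ hr.le (le_of_lt hx) 2
  -- Chebyshev's inequality, uniformly over the family.
  refine (measure_mono hsub).trans ((meas_ge_le_lintegral_div
    (Measurable.aemeasurable (by fun_prop)) ?_ ENNReal.ofReal_ne_top).trans ?_)
  · simpa using hr.ne'
  · gcongr
    exact h μ hμ

section Normalized

variable {Ω : Type*} [MeasurableSpace Ω] {P : Measure Ω} [IsProbabilityMeasure P] {w : ℝ} {n : ℕ}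
  {W : Ω → Matrix (Fin n) (Fin n) ℝ}

theorem normalize_apply (A : Matrix (Fin n) (Fin n) ℝ) (j k : Fin n) :
    normalize A j k = (√(n : ℝ))⁻¹ * A j k := rfl

theorem isSymm_normalize {A : Matrix (Fin n) (Fin n) ℝ} (hA : A.IsSymm) : (normalize A).IsSymm :=
  hA.smul _

theorem inv_sqrt_sq (n : ℕ) : (√(n : ℝ))⁻¹ ^ 2 = (n : ℝ)⁻¹ := by
  rw [inv_pow, Real.sq_sqrt (Nat.cast_nonneg n)]

omit [IsProbabilityMeasure P] in
theorem IsWigner.memLp_normalize (hW : IsWigner P w W) (j k : Fin n) :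
    MemLp (fun ω => normalize (W ω) j k) 2 P :=
  (hW.memLp_two j k).const_mul _

omit [IsProbabilityMeasure P] in
theorem IsWigner.integral_normalize (hW : IsWigner P w W) (j k : Fin n) :
    ∫ ω, normalize (W ω) j k ∂P = 0 := by
  simp_rw [normalize_apply]
  rw [integral_const_mul, hW.mean, mul_zero]

omit [IsProbabilityMeasure P] in
theorem IsWigner.integral_normalize_sq (hW : IsWigner P w W) (j k : Fin n) :
    ∫ ω, normalize (W ω) j k ^ 2 ∂P = (1 + if j = k then 1 else 0) * (w ^ 2 / n) := by
  simp_rw [normalize_apply, mul_pow]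
  rw [integral_const_mul, hW.second_moment, inv_sqrt_sq]
  ring

omit [IsProbabilityMeasure P] in
-- Rescaling by `√n` turns the threshold `τ` into `τ √n` and gives the second factor `n⁻¹`.
theorem IsWigner.sum_truncated_second_moment (hW : IsWigner P w W) (τ : ℝ) :
    (n : ℝ)⁻¹ * ∑ j, ∑ k, ∫ ω in {ω | τ < |normalize (W ω) j k|}, normalize (W ω) j k ^ 2 ∂P =
      lindebergSum P W τ := by
  have e : ∀ j k, ∫ ω in {ω | τ < |normalize (W ω) j k|}, normalize (W ω) j k ^ 2 ∂P =
      (n : ℝ)⁻¹ * ∫ x in {x : ℝ | τ * √(n : ℝ) < |x|}, x ^ 2 ∂(P.map fun ω => W ω j k) := by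
    intro j k
    have hn : (0 : ℝ) < √(n : ℝ) := Real.sqrt_pos.mpr (by exact_mod_cast j.pos)
    rw [setIntegral_map (s := {x : ℝ | τ * √(n : ℝ) < |x|}) (f := fun x : ℝ => x ^ 2)
      (measurableSet_lt measurable_const measurable_id.abs)
      (Measurable.aestronglyMeasurable (by fun_prop)) (hW.measurable j k).aemeasurable,
      ← integral_const_mul]
    have hs : {ω | τ < |normalize (W ω) j k|} =
        (fun ω => W ω j k) ⁻¹' {x : ℝ | τ * √(n : ℝ) < |x|} := by
      ext ω
      simp only [Set.mem_ofPred_eq, Set.mem_preimage, normalize_apply, abs_mul,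
        abs_of_pos (inv_pos.mpr hn)]
      rw [lt_inv_mul_iff₀ hn, mul_comm]
    rw [hs]
    simp_rw [normalize_apply, mul_pow, inv_sqrt_sq]
  simp_rw [e, lindebergSum, ← Finset.mul_sum]
  ring

/-- The place on or above the diagonal that carries the same entry as `(a, b)`. -/
def upperIndex (a b : Fin n) : {e : Fin n × Fin n // e.1 ≤ e.2} :=
  ⟨(min a b, max a b), min_le_max⟩

/-- The pair of minimum and maximum determines the unordered pair, so the places sharing an upper
index are exactly those that `eraseEntry` clears. -/
theorem upperIndex_eq_iff (a b j k : Fin n) :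
    upperIndex a b = upperIndex j k ↔ (a = j ∧ b = k) ∨ (a = k ∧ b = j) := by
  simp only [upperIndex, Subtype.mk.injEq, Prod.mk.injEq, Fin.ext_iff, Fin.coe_min, Fin.coe_max]
  omega

theorem apply_upperIndex {A : Matrix (Fin n) (Fin n) ℝ} (hA : A.IsSymm) (a b : Fin n) :
    A (upperIndex a b).1.1 (upperIndex a b).1.2 = A a b := by
  rcases le_total a b with h | h
  · simp [upperIndex, h]
  · simp [upperIndex, h, hA.apply a b]

omit [IsProbabilityMeasure P] in
-- The entry is a function of one member of the independent family, and the erased matrix is a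
-- function of the remaining members.
theorem IsWigner.indepFun_eraseEntry (hW : IsWigner P w W) (j k : Fin n) :
    IndepFun (fun ω => normalize (W ω) j k)
      (fun ω (a b : Fin n) => eraseEntry (normalize (W ω)) j k a b) P := by
  classical
  set e := upperIndex j k
  have h := hW.indep.indepFun_finset {e} (Finset.univ.erase e)
    (by simp) fun i => hW.measurable i.1.1 i.1.2
  set φ : (({e} : Finset {e : Fin n × Fin n // e.1 ≤ e.2}) → ℝ) → ℝ :=
    fun t => (√(n : ℝ))⁻¹ * t ⟨e, Finset.mem_singleton_self e⟩
  set ψ : (((Finset.univ.erase e) : Finset {e : Fin n × Fin n // e.1 ≤ e.2}) → ℝ) →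
      Fin n → Fin n → ℝ := fun t a b =>
    -- The default `0` at the missing index is the value that `eraseEntry` puts there.
    if hab : upperIndex a b ∈ Finset.univ.erase e then (√(n : ℝ))⁻¹ * t ⟨upperIndex a b, hab⟩ else 0
  have hφ : Measurable φ := (measurable_pi_apply _).const_mul _
  have hψ : Measurable ψ := by
    refine measurable_pi_lambda _ fun a => measurable_pi_lambda _ fun b => ?_
    simp only [ψ]
    split_ifs
    · exact (measurable_pi_apply _).const_mul _
    · exact measurable_const
  convert h.comp hφ hψ using 1
  · ext ω
    simp only [φ, Function.comp, normalize_apply, e]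
    rw [apply_upperIndex (hW.symm ω)]
  · ext ω a b
    rw [eraseEntry_apply (isSymm_normalize (hW.symm ω))]
    simp only [ψ, Function.comp, Finset.mem_erase, Finset.mem_univ, and_true, e, ne_eq,
      upperIndex_eq_iff]
    by_cases hc : (a = j ∧ b = k) ∨ (a = k ∧ b = j)
    · simp [hc]
    · simp only [hc, not_false_eq_true, if_false, dif_pos, normalize_apply]
      rw [apply_upperIndex (hW.symm ω)]

theorem IsWigner.lintegral_sq_expectedLaw_le [NeZero n] (hW : IsWigner P w W) :
    ∫⁻ x, ENNReal.ofReal (x ^ 2) ∂(hW.expectedLaw : Measure ℝ) ≤ ENNReal.ofReal (2 * w ^ 2) := by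
  have hn : (0 : ℝ) < n := by exact_mod_cast Nat.pos_of_ne_zero (NeZero.ne n)
  refine (lintegral_sq_expectedCountingMeasure hW.measurable_normalize hW.isHermitian_normalize
    hW.memLp_normalize).le.trans (ENNReal.ofReal_le_ofReal ?_)
  have h1 : ∀ j k, ∫ ω, normalize (W ω) j k ^ 2 ∂P ≤ 2 * (w ^ 2 / n) := by
    intro j k
    rw [hW.integral_normalize_sq]
    have : 0 ≤ w ^ 2 / n := by positivity
    split_ifs <;> linarith
  calc (n : ℝ)⁻¹ * ∑ j, ∑ k, ∫ ω, normalize (W ω) j k ^ 2 ∂P ≤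
      (n : ℝ)⁻¹ * ∑ _j : Fin n, ∑ _k : Fin n, 2 * (w ^ 2 / n) := by
        gcongr with j _ k _
        exact h1 j k
    _ = 2 * w ^ 2 := by
        simp only [Finset.sum_const, Finset.card_univ, Fintype.card_fin, nsmul_eq_mul]
        field_simp

/-- Jensen's inequality, read off from the nonnegativity of the variance of `‖f‖`. -/
theorem norm_sq_integral_le {f : Ω → ℂ} (hf : Measurable f) {C : ℝ} (hC : ∀ ω, ‖f ω‖ ≤ C) :
    ‖∫ ω, f ω ∂P‖ ^ 2 ≤ ∫ ω, ‖f ω‖ ^ 2 ∂P := by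
  have hL : MemLp (fun ω => ‖f ω‖) 2 P := MemLp.of_bound hf.norm.aestronglyMeasurable C
    (Eventually.of_forall fun ω => by simpa using hC ω)
  have h1 := variance_nonneg (fun ω => ‖f ω‖) P
  rw [variance_eq_sub hL] at h1
  have h2 : ‖∫ ω, f ω ∂P‖ ^ 2 ≤ (∫ ω, ‖f ω‖ ∂P) ^ 2 :=
    pow_le_pow_left₀ (norm_nonneg _) (norm_integral_le_integral_norm _) 2
  simp only [Pi.pow_apply] at h1
  linarith

/-- A quantitative form of the semicircle law, at the level of Stieltjes transforms. -/
theorem IsWigner.norm_sq_stieltjes_sub_le [NeZero n] (hW : IsWigner P w W) {z s : ℂ} (hz : 0 < z.im)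
    (hzw : 0 ≤ z.im - 2 * w ^ 2 * z.im⁻¹) (hs : ‖s‖ ≤ z.im⁻¹)
    (hs' : 1 + z * s + w ^ 2 * s ^ 2 = 0) {τ : ℝ} (hτ : 0 < τ) :
    (z.im - 2 * w ^ 2 * z.im⁻¹) *
        ‖∫ x, ((x : ℂ) - z)⁻¹ ∂(hW.expectedLaw : Measure ℝ) - s‖ ^ 2 ≤
      6 * (z.im⁻¹) ^ 3 * w ^ 2 / n + 36 * (z.im⁻¹) ^ 4 * w ^ 2 * τ +
        40 * (z.im⁻¹) ^ 4 * w ^ 4 / τ / n + 8 * (z.im⁻¹) ^ 3 * lindebergSum P W τ := by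
  have hsymm : ∀ ω, (normalize (W ω)).IsSymm := fun ω => isSymm_normalize (hW.symm ω)
  have hm := hW.measurable_normalize
  have h1 := norm_integral_selfConsistent_le (NeZero.ne n) hsymm hm hz hs hτ hW.memLp_normalize
    hW.integral_normalize hW.integral_normalize_sq hW.indepFun_eraseEntry
  rw [hW.sum_truncated_second_moment] at h1
  have h2 := integral_norm_sq_sub_le (P := P) hsymm hm hz hs hs'
  have hgm : Measurable fun ω => (resolventMatrix (normalize (W ω)) z).trace / n :=
    (measurable_trace_resolventMatrix hm z).div_const _
  have hg := fun ω => norm_trace_resolventMatrix_div_le (hsymm ω) hz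
  have h3 := norm_sq_integral_le (P := P) (hgm.sub_const s) (C := 2 * z.im⁻¹) fun ω =>
    (norm_sub_le _ _).trans (by linarith [hg ω])
  have hgi : Integrable (fun ω => (resolventMatrix (normalize (W ω)) z).trace / n) P :=
    Integrable.of_bound hgm.aestronglyMeasurable _ (Eventually.of_forall hg)
  have e : ∫ x, ((x : ℂ) - z)⁻¹ ∂(hW.expectedLaw : Measure ℝ) - s =
      ∫ ω, ((resolventMatrix (normalize (W ω)) z).trace / n - s) ∂P := by
    rw [integral_sub hgi (integrable_const s), integral_const, probReal_univ, one_smul]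
    congr 1
    exact integral_stieltjes_expectedCountingMeasure hm hW.isHermitian_normalize hz.ne'
  rw [e]
  exact (mul_le_mul_of_nonneg_left h3 hzw).trans (h2.trans h1)

end Normalized

end Wigner

/-! ### The semicircle law -/

theorem theorem3p2 {Ω : ℕ+ → Type*} [∀ n, MeasurableSpace (Ω n)]
    (P : ∀ n, Measure (Ω n)) [∀ n, IsProbabilityMeasure (P n)]
    (w : ℝ) (hw : 0 < w)
    (W : ∀ n : ℕ+, Ω n → Matrix (Fin n) (Fin n) ℝ)
    (hW : ∀ n, Wigner.IsWigner (P n) w (W n))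
    (hL : ∀ τ : ℝ, 0 < τ →
      Tendsto (fun n : ℕ+ => Wigner.lindebergSum (P n) (W n) τ) atTop (𝓝 0)) :
    Tendsto (fun n : ℕ+ => (hW n).expectedLaw) atTop (𝓝 (Wigner.semicircleLaw w hw)) := by
  refine Wigner.tendsto_of_tendsto_stieltjes (Wigner.isTightMeasureSet_of_lintegral_sq_le
    (C := ENNReal.ofReal (2 * w ^ 2)) ENNReal.ofReal_ne_top ?_) (2 * w) fun z hz hzw => ?_
  · rintro _ ⟨n, rfl⟩
    exact (hW n).lintegral_sq_expectedLaw_le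
  have := Wigner.isProbabilityMeasure_semicircleMeasure hw
  change Tendsto _ _ (𝓝 (∫ x, ((x : ℂ) - z)⁻¹ ∂(Wigner.semicircleMeasure w)))
  have hs' := Wigner.stieltjes_semicircle_quadratic hw hz.ne'
  have hs : ‖∫ x, ((x : ℂ) - z)⁻¹ ∂(Wigner.semicircleMeasure w)‖ ≤ z.im⁻¹ := by
    refine (norm_integral_le_of_norm_le_const (Eventually.of_forall fun x =>
      Wigner.norm_inv_ofReal_sub_le hz.ne' x)).trans ?_
    simp [abs_of_pos hz]
  set s := ∫ x, ((x : ℂ) - z)⁻¹ ∂(Wigner.semicircleMeasure w)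
  set b := z.im⁻¹
  have hb : 0 < b := inv_pos.mpr hz
  set δ := z.im - 2 * w ^ 2 * b
  -- Here `Im z > 2w` gives `(Im z)² > 4w² > 2w²`.
  have hδ : 0 < δ := by
    have h1 : z.im * b = 1 := mul_inv_cancel₀ hz.ne'
    have h2 : δ = (z.im ^ 2 - 2 * w ^ 2) * b := by
      simp only [δ]
      linear_combination (-z.im) * h1
    rw [h2]
    refine mul_pos ?_ hb
    nlinarith
  have hinv : Tendsto (fun n : ℕ+ => ((n : ℕ) : ℝ)⁻¹) atTop (𝓝 0) :=
    tendsto_inv_atTop_nhds_zero_nat.comp tendsto_PNat_val_atTop_atTop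
  rw [tendsto_iff_norm_sub_tendsto_zero, Metric.tendsto_nhds]
  intro ε hε
  -- Chosen so that the one error term that does not vanish as `n → ∞` equals `δ ε² / 2`; the others
  -- are eventually smaller than the other half.
  set τ := δ * ε ^ 2 / 2 / (36 * b ^ 4 * w ^ 2)
  have hτ : 0 < τ := by positivity
  have hrest : Tendsto (fun n : ℕ+ => 6 * b ^ 3 * w ^ 2 * ((n : ℕ) : ℝ)⁻¹ +
      40 * b ^ 4 * w ^ 4 / τ * ((n : ℕ) : ℝ)⁻¹ +
      8 * b ^ 3 * Wigner.lindebergSum (P n) (W n) τ) atTop (𝓝 0) := by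
    simpa using ((hinv.const_mul (6 * b ^ 3 * w ^ 2)).add
      (hinv.const_mul (40 * b ^ 4 * w ^ 4 / τ))).add ((hL τ hτ).const_mul (8 * b ^ 3))
  filter_upwards [hrest.eventually_lt_const (u := δ * ε ^ 2 / 2) (by positivity)] with n hn
  have h1 := (hW n).norm_sq_stieltjes_sub_le hz hδ.le hs hs' hτ
  have h2 : 36 * b ^ 4 * w ^ 2 * τ = δ * ε ^ 2 / 2 :=
    mul_div_cancel₀ _ (by positivity)
  rw [h2, div_eq_mul_inv, div_eq_mul_inv _ ((n : ℕ) : ℝ)] at h1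
  have h3 : δ * ‖∫ x, ((x : ℂ) - z)⁻¹ ∂((hW n).expectedLaw : Measure ℝ) - s‖ ^ 2 < δ * ε ^ 2 := by
    linarith
  rw [dist_zero_right, norm_norm]
  exact lt_of_pow_lt_pow_left₀ 2 hε.le (lt_of_mul_lt_mul_left h3 hδ.le)
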